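/- Let $G$ be a finite or countable directed graph (countably many vertices and edges; loops and parallel edges are allowed). Let $\mathbb F^+(G)$ be its free semigroupoid, i.e. the set of all finite directed paths, including the vertices as paths of length $0$, with concatenation written from right to left ($w=ywx$ means that $w$ starts at $x$ and ends at $y$). Let $\mathcal H_G=\ell^2(\mathbb F^+(G))$ with orthonormal basis $\{\xi_w\}$. For $u$ an edge or a vertex let $L_u\xi_w=\xi_{uw}$ if $uw\in\mathbb F^+(G)$ and $L_u\xi_w=0$ otherwise. Let $\mathfrak L_G\subseteq\mathcal B(\mathcal H_G)$ be the algebra closed in the weak operator topology (WOT) that is generated by all $L_e$ ($e$ an edge) and $L_x$ ($x$ a vertex). Let $\mathfrak L_2$ be the algebra $\mathfrak L_G$ of the graph with one vertex and two loops. A cycle at a vertex $x$ is a path $w=xwx$ of positive length for which only the initial edge has source $x$. The graph contains a double-cycle if there are two distinct cycles at some vertex. A proper infinite path is an infinite directed path $\cdots e_3e_2e_1$ in which no edge is repeated. An infinite directed path is aperiodic if its sequence of edges is not eventually periodic. A WOT-closed algebra $\mathfrak A$ is partly free if there is a map $\mathfrak L_2\to\mathfrak A$ that is the restriction of an injective (not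 necessarily unital) $*$-homomorphism from the von Neumann algebra generated by $\mathfrak L_2$ to the one generated by $\mathfrak A$. **Theorem.** The following assertions are equivalent. 1. (i) $G$ has the aperiodic path property: there is an aperiodic infinite path in $G$. 2. (i$'$) $G$ contains a double-cycle or a proper infinite path. 3. (ii) $\mathfrak L_G$ is partly free. 4. (iii) There are nonzero partial isometries $U,V\in\mathfrak L_G$ with $U^*U=V^*V$, $UU^*\le U^*U$, $VV^*\le V^*V$ and $U^*V=0$. -/

import Mathlib

universe v u

/-! ### Directed graphs

A directed graph (parallel edges and loops allowed) is a quiver on its vertex set `V`; the edges with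
source `x` and target `y` form the type `x ⟶ y`. A path `w = y w x` is a `Quiver.Path x y`; the path
"first `w`, then `w'`" (written `w'w` in right-to-left notation) is `w.comp w'`. -/

namespace DirGraph

/-- A cycle at `x`: a path `w` of at least one edge from `x` to `x` such that only the initial edge
of `w` has source `x`, i.e. whenever `w` is "`a`, then the edge `e`, then `b`" and `e` has
source `x`, the path `a` is empty. -/
def IsCycle {V : Type u} [Quiver.{v} V] {x : V} (w : Quiver.Path x x) : Prop :=
  0 < w.length ∧
    ∀ (a : Quiver.Path x x) (y : V) (e : x ⟶ y) (b : Quiver.Path y x),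
      w = (a.cons e).comp b → a.length = 0

/-- The graph contains a double-cycle: two distinct cycles at the same vertex. -/
def HasDoubleCycle (V : Type u) [Quiver.{v} V] : Prop :=
  ∃ (x : V) (w₁ w₂ : Quiver.Path x x), IsCycle w₁ ∧ IsCycle w₂ ∧ w₁ ≠ w₂

/-- An infinite directed path: consecutive edges `edge 0, edge 1, edge 2, …`. -/
structure InfinitePath (V : Type u) [Quiver.{v} V] where
  /-- the vertices visited -/
  vertex : ℕ → V
  /-- the edges traversed -/
  edge : ∀ n, vertex n ⟶ vertex (n + 1)

/-- The `n`-th edge of an infinite path, as an element of the set of all edges of the graph. -/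
def InfinitePath.arrow {V : Type u} [Quiver.{v} V] (ω : InfinitePath V) (n : ℕ) : Quiver.Total V :=
  ⟨ω.vertex n, ω.vertex (n + 1), ω.edge n⟩

/-- A proper infinite path: no edge is repeated. -/
def InfinitePath.IsProper {V : Type u} [Quiver.{v} V] (ω : InfinitePath V) : Prop :=
  Function.Injective ω.arrow

/-- The infinite path becomes periodic: from some index on, its sequence of edges is periodic. -/
def InfinitePath.IsEventuallyPeriodic {V : Type u} [Quiver.{v} V] (ω : InfinitePath V) : Prop :=
  ∃ N p : ℕ, 0 < p ∧ ∀ n, N ≤ n → ω.arrow (n + p) = ω.arrow n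

/-! ### The Fock space and the partial creation operators -/

/-- The free semigroupoid of the graph: all finite paths, `⟨x, y, w⟩` with `w` a path from `x`
to `y`. The vertices are the paths of length `0`. -/
abbrev FreeSemigroupoid (V : Type u) [Quiver.{v} V] : Type (max u v) :=
  Σ x y : V, Quiver.Path x y

/-- The Hilbert space `ℓ²` over an index set. -/
abbrev EllTwo (ι : Type*) : Type _ := lp (fun _ : ι => ℂ) 2

/-- The standard orthonormal basis of `ℓ²(ι)`. -/
noncomputable def stdBasis (ι : Type*) : HilbertBasis ι ℂ (EllTwo ι) :=
  HilbertBasis.ofRepr (LinearIsometryEquiv.refl ℂ (EllTwo ι))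

/-- The isometry `ℓ²(κ) → ℓ²(ι)` that sends the basis vector of `k` to the basis vector
of `φ k`. -/
noncomputable def basisIsometry {κ ι : Type*} (φ : κ ↪ ι) : EllTwo κ →ₗᵢ[ℂ] EllTwo ι :=
  ((stdBasis ι).orthonormal.comp φ φ.injective).orthogonalFamily.linearIsometry

theorem basisIsometry_apply {κ ι : Type*} (φ : κ ↪ ι) (k : κ) :
    basisIsometry φ (stdBasis κ k) = stdBasis ι (φ k) := by
  classical
  have h : stdBasis κ k = lp.single 2 k (1 : ℂ) := by
    rw [← HilbertBasis.repr_symm_single]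
    rfl
  rw [h, basisIsometry, OrthogonalFamily.linearIsometry_apply_single]
  simp

/-- The Fock space `ℋ_G = ℓ²(𝔽⁺(G))` of the graph. -/
abbrev Fock (V : Type u) [Quiver.{v} V] : Type (max u v) := EllTwo (FreeSemigroupoid V)

/-- The vector `ξ_w` of the canonical orthonormal basis of the Fock space. -/
noncomputable def ξ {V : Type u} [Quiver.{v} V] (w : FreeSemigroupoid V) : Fock V :=
  stdBasis (FreeSemigroupoid V) w

/-- The paths with final vertex `x`, as elements of the free semigroupoid. -/
def pathsTo {V : Type u} [Quiver.{v} V] (x : V) :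
    (Σ z : V, Quiver.Path z x) ↪ FreeSemigroupoid V where
  toFun w := ⟨w.1, x, w.2⟩
  inj' := by
    rintro ⟨z, w⟩ ⟨z', w'⟩ h
    simp only [Sigma.mk.injEq] at h
    obtain ⟨rfl, h⟩ := h
    simpa using h

/-- The map `w ↦ pw` on the paths `w` whose final vertex is the initial vertex of `p`. -/
def followBy {V : Type u} [Quiver.{v} V] {x y : V} (p : Quiver.Path x y) :
    (Σ z : V, Quiver.Path z x) ↪ FreeSemigroupoid V where
  toFun w := ⟨w.1, y, w.2.comp p⟩
  inj' := by
    rintro ⟨z, w⟩ ⟨z', w'⟩ h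
    simp only [Sigma.mk.injEq] at h
    obtain ⟨rfl, h⟩ := h
    simpa using h

/-- The partial creation operator `L_p` of a path `p`: it sends `ξ_w` to `ξ_{pw}` if `pw` is a path,
and to `0` otherwise (see the two lemmas below). -/
noncomputable def creation {V : Type u} [Quiver.{v} V] {x y : V} (p : Quiver.Path x y) :
    Fock V →L[ℂ] Fock V :=
  (basisIsometry (followBy p)).toContinuousLinearMap ∘L
    ContinuousLinearMap.adjoint (basisIsometry (pathsTo x)).toContinuousLinearMap

theorem creation_apply {V : Type u} [Quiver.{v} V] {z x y : V} (p : Quiver.Path x y)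
    (w : Quiver.Path z x) : creation p (ξ ⟨z, x, w⟩) = ξ ⟨z, y, w.comp p⟩ := by
  have h : ξ ⟨z, x, w⟩ = (basisIsometry (pathsTo x)).toContinuousLinearMap
      (stdBasis _ (⟨z, w⟩ : Σ z : V, Quiver.Path z x)) :=
    (basisIsometry_apply (pathsTo x) ⟨z, w⟩).symm
  have h2 := ContinuousLinearMap.ext_iff.1
    ((ContinuousLinearMap.norm_map_iff_adjoint_comp_self
      (basisIsometry (pathsTo x)).toContinuousLinearMap).1
      (basisIsometry (pathsTo x)).norm_map)
    (stdBasis _ (⟨z, w⟩ : Σ z : V, Quiver.Path z x))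
  rw [creation, ContinuousLinearMap.comp_apply, h]
  refine Eq.trans (congrArg _ h2) ?_
  exact basisIsometry_apply (followBy p) ⟨z, w⟩

theorem creation_apply_of_ne {V : Type u} [Quiver.{v} V] {z x x' y : V} (p : Quiver.Path x y)
    (w : Quiver.Path z x') (hx : x' ≠ x) : creation p (ξ ⟨z, x', w⟩) = 0 := by
  have h : ContinuousLinearMap.adjoint (basisIsometry (pathsTo x)).toContinuousLinearMap
      (ξ ⟨z, x', w⟩) = 0 := by
    refine (stdBasis _).repr.injective ?_
    ext k
    rw [HilbertBasis.repr_apply_apply, ContinuousLinearMap.adjoint_inner_right]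
    have h3 : (basisIsometry (pathsTo x)).toContinuousLinearMap (stdBasis _ k) =
        stdBasis _ (pathsTo x k) := basisIsometry_apply _ _
    rw [h3, ξ, (stdBasis (FreeSemigroupoid V)).orthonormal.2]
    · simp
    · intro h4
      exact hx (congrArg (fun q : FreeSemigroupoid V => q.2.1) h4).symm
  rw [creation, ContinuousLinearMap.comp_apply, h, map_zero]

/-! ### Operator algebras -/

/-- A set of bounded operators is closed in the weak operator topology. -/
def IsWOTClosed {H : Type*} [NormedAddCommGroup H] [InnerProductSpace ℂ H]
    (S : Set (H →L[ℂ] H)) : Prop :=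
  IsClosed {T : H →WOT[ℂ] H | T.toCLM ∈ S}

/-- The WOT-closed algebra generated by a set of operators: the smallest WOT-closed algebra of
operators that contains the set. -/
noncomputable def wotAlg {H : Type*} [NormedAddCommGroup H] [InnerProductSpace ℂ H]
    (S : Set (H →L[ℂ] H)) : NonUnitalSubalgebra ℂ (H →L[ℂ] H) :=
  sInf {A | IsWOTClosed (A : Set (H →L[ℂ] H)) ∧ S ⊆ A}

/-- The free semigroupoid algebra `𝔏_G`: the WOT-closed algebra generated by the `L_x`, `x` a vertex,
and the `L_e`, `e` an edge. -/
noncomputable def freeSemigroupoidAlgebra (V : Type u) [Quiver.{v} V] :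
    NonUnitalSubalgebra ℂ (Fock V →L[ℂ] Fock V) :=
  wotAlg ({T | ∃ x : V, T = creation (Quiver.Path.nil : Quiver.Path x x)} ∪
    {T | ∃ (x y : V) (e : x ⟶ y), T = creation e.toPath})

/-- The graph with one vertex and two loops. -/
abbrev TwoLoops : Type := Quiver.SingleObj (Fin 2)

/-- The free semigroup algebra `𝔏₂`: the free semigroupoid algebra of the graph with one vertex and
two loops. -/
noncomputable def freeSemigroupAlgebraTwo :
    NonUnitalSubalgebra ℂ (Fock TwoLoops →L[ℂ] Fock TwoLoops) :=
  freeSemigroupoidAlgebra TwoLoops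

/-- The von Neumann algebra generated by a set of operators: the double commutant of the set
together with its adjoints. -/
noncomputable def generatedVonNeumannAlgebra {H : Type*} [NormedAddCommGroup H]
    [InnerProductSpace ℂ H] [CompleteSpace H] (S : Set (H →L[ℂ] H)) : VonNeumannAlgebra H where
  toStarSubalgebra :=
    StarSubalgebra.centralizer ℂ (StarSubalgebra.centralizer ℂ S : Set (H →L[ℂ] H))
  centralizer_centralizer' := by
    change Set.centralizer (Set.centralizer (StarSubalgebra.centralizer ℂ
      (StarSubalgebra.centralizer ℂ S : Set (H →L[ℂ] H)) : Set (H →L[ℂ] H))) =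
      (StarSubalgebra.centralizer ℂ
        (StarSubalgebra.centralizer ℂ S : Set (H →L[ℂ] H)) : Set (H →L[ℂ] H))
    rw [StarSubalgebra.coe_centralizer, Set.centralizer_centralizer_centralizer]

/-- An operator algebra `A` is partly free if there is an inclusion map `𝔏₂ → A` that is the
restriction of an injection (an injective `*`-homomorphism, not necessarily unital) of the von
Neumann algebra generated by `𝔏₂` into the one generated by `A`.
No continuity is imposed. The von Neumann algebra generated by `𝔏₂` is all of `B(H)`, `H` separable,
and every `*`-homomorphism of it into the operators on a separable Hilbert space is normal. -/
def IsPartlyFree {H : Type*} [NormedAddCommGroup H] [InnerProductSpace ℂ H] [CompleteSpace H]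
    (A : NonUnitalSubalgebra ℂ (H →L[ℂ] H)) : Prop :=
  ∃ φ : (generatedVonNeumannAlgebra
            (freeSemigroupAlgebraTwo : Set (Fock TwoLoops →L[ℂ] Fock TwoLoops))).toStarSubalgebra →⋆ₙₐ[ℂ]
          (generatedVonNeumannAlgebra (A : Set (H →L[ℂ] H))).toStarSubalgebra,
    Function.Injective φ ∧
      ∀ T : (generatedVonNeumannAlgebra
          (freeSemigroupAlgebraTwo : Set (Fock TwoLoops →L[ℂ] Fock TwoLoops))).toStarSubalgebra,
        (T : Fock TwoLoops →L[ℂ] Fock TwoLoops) ∈ freeSemigroupAlgebraTwo →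
          (φ T : H →L[ℂ] H) ∈ A

/-- A partial isometry: `U U* U = U`. -/
def IsPartialIsometry {H : Type*} [NormedAddCommGroup H] [InnerProductSpace ℂ H] [CompleteSpace H]
    (U : H →L[ℂ] H) : Prop :=
  U * star U * U = U

end DirGraph

/-! Combinatorics. Neither of two distinct cycles at a vertex begins the other, so binary sequences
spell distinct infinite paths; only countably many of these are eventually periodic. Without
double-cycles, a path returning to a vertex infinitely often repeats the one cycle there, so an
aperiodic path visits each vertex finitely often, and jumping to last visits makes its vertices
distinct (`exists_injective_vertex`).

From paths to operators. A double-cycle or a path with distinct vertices yields vertices `x k` and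
paths `p i k` under which words in two letters act freely on the paths ending in some `x k`. Each
orbit is a copy of the words, indexed by its generating path, so `T ↦ ⨁ T` over the orbits is an
injective `*`-homomorphism. Generators of `𝔏₂` go to strong sums of creation operators. Passing to
all of `𝔏₂` needs WOT continuity, which is delicate for infinite sums of copies. But `𝔏₂` commutes
with the right creation operators of the words "`n` times the first loop, then the second",
isometries with orthogonal ranges; on their commutant `⨁ T` is a compression of `T`
(`ampliation_eq_of_commute`), hence WOT continuous. The images of the two generators of `𝔏₂` are the
desired partial isometries.

From operators to paths. Suppose that `U`, `W` are given and all infinite paths are eventually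
periodic. The initial projection commutes with the right creation operators, so it projects onto the
paths ending in a set `X` (`IsPartialIsometry.exists_initial_vertices`). Periodicity gives `x ∈ X`
to which one can return from every vertex of `X` reachable from it. The paths from `x` to `X` span
one dimension or carry a shift of finite multiplicity `n`, namely prepending the cycle at `x`. Both
operators preserve this space and commute with the shift, so their orthogonal ranges would give
multiplicity `2n` inside multiplicity `n`, which `card_le_card_of_shift` excludes. -/

namespace DirGraph

open Quiver Filter Topology
open scoped InnerProductSpace ENNReal

/-! ### Paths as lists of arrows -/

/-- The list of the edges of a path, in the order in which they are traversed. -/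
def arrows {V : Type u} [Quiver.{v} V] {a : V} : ∀ {b : V}, Path a b → List (Total V)
  | _, .nil => []
  | _, .cons p e => arrows p ++ [⟨_, _, e⟩]

section Paths

variable {V : Type u} [Quiver.{v} V]

@[simp] theorem arrows_nil {a : V} : arrows (Path.nil : Path a a) = [] := rfl

@[simp] theorem arrows_cons {a b c : V} (p : Path a b) (e : b ⟶ c) :
    arrows (p.cons e) = arrows p ++ [⟨b, c, e⟩] := rfl

@[simp] theorem length_arrows {a b : V} (p : Path a b) : (arrows p).length = p.length := by
  induction p with
  | nil => rfl
  | cons p e ih => simp [ih]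

theorem arrows_comp {a b c : V} (p : Path a b) (q : Path b c) :
    arrows (p.comp q) = arrows p ++ arrows q := by
  induction q with
  | nil => simp
  | cons q e ih => simp [ih]

theorem arrows_getLast? {a b : V} (p : Path a b) : ∀ t ∈ (arrows p).getLast?, t.right = b := by
  cases p with
  | nil => simp
  | cons p e => simp

theorem arrows_head? {a b : V} (p : Path a b) : ∀ t ∈ (arrows p).head?, t.left = a := by
  induction p with
  | nil => simp
  | cons p e ih =>
    cases p with
    | nil => simp
    | cons p e' =>
      intro t ht
      refine ih t ?_
      rw [arrows_cons, List.head?_append_of_ne_nil _ (by simp)] at ht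
      exact ht

theorem isChain_arrows {a b : V} (p : Path a b) :
    (arrows p).IsChain (fun s t => s.right = t.left) := by
  induction p with
  | nil => simp
  | cons p e ih =>
    rw [arrows_cons, List.isChain_append]
    refine ⟨ih, by simp, ?_⟩
    intro s hs t ht
    rw [arrows_getLast? p s hs]
    simp at ht
    rw [← ht]

/-- Edge lists allow paths with different final vertices to be compared without heterogeneous
equality. The common source is needed because an empty list does not remember its vertex. -/
theorem exists_eq_comp_of_arrows_prefix {a b c : V} (p : Path a b) (q : Path a c)
    (h : arrows p <+: arrows q) : ∃ r : Path b c, q = p.comp r := by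
  induction q generalizing b with
  | nil =>
    cases p with
    | nil => exact ⟨.nil, rfl⟩
    | cons p e => simp at h
  | cons q e ih =>
    rw [arrows_cons, List.prefix_concat_iff] at h
    rcases h with h | h
    · cases p with
      | nil => simp at h
      | cons p e' =>
        rw [arrows_cons] at h
        obtain ⟨h1, h2⟩ := List.append_inj' h rfl
        simp only [List.cons.injEq, Total.mk.injEq, and_true] at h2
        obtain ⟨rfl, rfl, h2⟩ := h2
        obtain rfl := eq_of_heq h2
        obtain ⟨r, hr⟩ := ih p (by rw [h1])
        have : r.length = 0 := by
          have := congrArg Path.length hr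
          rw [Path.length_comp, ← length_arrows, ← length_arrows, h1] at this
          lia
        rw [Path.eq_nil_of_length_zero r this] at hr
        exact ⟨.nil, by rw [hr]; rfl⟩
    · obtain ⟨r, rfl⟩ := ih p h
      exact ⟨r.cons e, rfl⟩

theorem exists_eq_comp_of_comp_eq_comp {a b c d : V} {p : Path a b} {q : Path b d} {p' : Path a c}
    {q' : Path c d} (h : p.comp q = p'.comp q') (hl : p.length ≤ p'.length) :
    ∃ r : Path b c, p' = p.comp r := by
  apply exists_eq_comp_of_arrows_prefix
  refine List.prefix_of_prefix_length_le (l₃ := arrows (p.comp q)) ?_ ?_ (by simpa using hl)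
  · rw [arrows_comp]; exact List.prefix_append _ _
  · rw [h, arrows_comp]; exact List.prefix_append _ _

/-! ### Cycles -/

/-- If `r` were nonempty, its first edge would leave `x` in the middle of the cycle `d`. -/
theorem IsCycle.eq_of_eq_comp {x : V} {c d r : Path x x} (hc : IsCycle c) (hd : IsCycle d)
    (h : d = c.comp r) : c = d := by
  by_cases hr : r.length = 0
  · rw [h, Path.eq_nil_of_length_zero r hr, Path.comp_nil]
  · obtain ⟨y, e, r', hr', -⟩ := (Path.length_ne_zero_iff_eq_comp r).1 hr
    have h0 := hd.2 c y e r' (by rw [h, hr', ← Path.comp_toPath_eq_cons, Path.comp_assoc])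
    exact absurd h0 hc.1.ne'

/-- The first edge of `c` has source `x`; inside the cycle `d` it can only be the initial edge, so
`r` is empty. -/
theorem IsCycle.eq_of_eq_comp_left {x : V} {c d r : Path x x} (hc : IsCycle c) (hd : IsCycle d)
    (h : d = r.comp c) : c = d := by
  obtain ⟨y, e, c', hc', -⟩ := (Path.length_ne_zero_iff_eq_comp c).1 hc.1.ne'
  have h0 := hd.2 r y e c' (by rw [h, hc', ← Path.comp_toPath_eq_cons, Path.comp_assoc])
  rw [h, Path.eq_nil_of_length_zero r h0, Path.nil_comp]

theorem exists_eq_comp_right {a b c d : V} {p : Path a b} {q : Path b d} {p' : Path a c}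
    {q' : Path c d} (h : p.comp q = p'.comp q') (hl : p.length ≤ p'.length) :
    ∃ r : Path b c, q = r.comp q' := by
  obtain ⟨r, rfl⟩ := exists_eq_comp_of_comp_eq_comp h hl
  rw [Path.comp_assoc, Path.comp_inj_right] at h
  exact ⟨r, h⟩

/-- Two cycles at a vertex that are comparable as final segments are equal. -/
theorem IsCycle.eq_of_comp_eq_comp {x y : V} {c d : Path x x} (hc : IsCycle c) (hd : IsCycle d)
    {q q' : Path y x} (h : q.comp c = q'.comp d) : c = d := by
  rcases le_total q.length q'.length with hl | hl
  · obtain ⟨r, hr⟩ := exists_eq_comp_right h hl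
    exact (hd.eq_of_eq_comp_left hc hr).symm
  · obtain ⟨r, hr⟩ := exists_eq_comp_right h.symm hl
    exact hc.eq_of_eq_comp_left hd hr

/-- A closed path of positive length starts with a cycle. -/
theorem exists_isCycle_comp {x : V} (w : Path x x) (hw : 0 < w.length) :
    ∃ c r : Path x x, IsCycle c ∧ w = c.comp r := by
  induction hn : w.length using Nat.strong_induction_on generalizing w with
  | _ n ih =>
    by_cases h : IsCycle w
    · exact ⟨w, .nil, h, rfl⟩
    · simp only [IsCycle, hw, true_and] at h
      push Not at h
      -- A closed path that is not a cycle leaves `x` again after a nonempty initial segment `a`,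
      -- which is a shorter closed path.
      obtain ⟨a, y, e, b, rfl, ha⟩ := h
      obtain ⟨c, r, hc, rfl⟩ := ih a.length (by simp at hn; lia) a (by lia) rfl
      exact ⟨c, r.comp ((e.toPath).comp b), hc, by
        rw [← Path.comp_toPath_eq_cons]; simp only [Path.comp_assoc]⟩

/-- In a graph without double-cycles, all closed paths of positive length at a vertex start with
the same cycle. -/
theorem exists_unique_first_cycle (h : ¬ HasDoubleCycle V) {x : V} (w : Path x x)
    (hw : 0 < w.length) :
    ∃ c : Path x x, IsCycle c ∧ ∀ w' : Path x x, 0 < w'.length → ∃ r, w' = c.comp r := by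
  obtain ⟨c, -, hc, -⟩ := exists_isCycle_comp w hw
  refine ⟨c, hc, fun w' hw' => ?_⟩
  obtain ⟨c', r, hc', rfl⟩ := exists_isCycle_comp w' hw'
  have : c' = c := by
    by_contra hne
    exact h ⟨x, c', c, hc', hc, hne⟩
  exact ⟨r, by rw [this]⟩

/-! ### Infinite paths -/

namespace InfinitePath

/-- The segment of `n` edges of an infinite path that starts at index `i`. -/
def segment (ω : InfinitePath V) (i : ℕ) : ∀ n : ℕ, Path (ω.vertex i) (ω.vertex (i + n))
  | 0 => .nil
  | n + 1 => (segment ω i n).cons (ω.edge (i + n))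

@[simp] theorem length_segment (ω : InfinitePath V) (i n : ℕ) : (ω.segment i n).length = n := by
  induction n with
  | zero => rfl
  | succ n ih => simp [segment, ih]

theorem arrows_segment (ω : InfinitePath V) (i n : ℕ) :
    arrows (ω.segment i n) = (List.range n).map fun k => ω.arrow (i + k) := by
  induction n with
  | zero => rfl
  | succ n ih => rw [List.range_succ, List.map_append, ← ih]; rfl

theorem nonempty_path (ω : InfinitePath V) {i j : ℕ} (h : i ≤ j) :
    Nonempty (Path (ω.vertex i) (ω.vertex j)) := by
  obtain ⟨n, rfl⟩ := Nat.exists_eq_add_of_le h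
  exact ⟨ω.segment i n⟩

/-- The infinite path with a given sequence of edges. -/
def ofArrows (f : ℕ → Total V) (hf : ∀ n, (f n).right = (f (n + 1)).left) : InfinitePath V where
  vertex n := (f n).left
  edge n := hf n ▸ (f n).hom

theorem arrow_ofArrows (f : ℕ → Total V) (hf : ∀ n, (f n).right = (f (n + 1)).left) (n : ℕ) :
    (ofArrows f hf).arrow n = f n := by
  have key : ∀ (t : Total V) (x : V) (h : t.right = x), (⟨t.left, x, h ▸ t.hom⟩ : Total V) = t := by
    rintro t x rfl
    rfl
  exact key (f n) _ (hf n)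

theorem IsProper.not_isEventuallyPeriodic {ω : InfinitePath V} (h : ω.IsProper) :
    ¬ ω.IsEventuallyPeriodic := by
  rintro ⟨N, p, hp, hN⟩
  have := h (hN N le_rfl)
  lia

theorem isProper_of_injective {ω : InfinitePath V} (h : Function.Injective ω.vertex) :
    ω.IsProper := fun _ _ hmn => h (congrArg Total.left hmn)

end InfinitePath

/-- The concatenation of the first `n` paths of a sequence of composable paths. -/
def concat {x : ℕ → V} (p : ∀ n, Path (x n) (x (n + 1))) : ∀ n, Path (x 0) (x n)
  | 0 => .nil
  | n + 1 => (concat p n).comp (p n)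

theorem le_length_concat {x : ℕ → V} (p : ∀ n, Path (x n) (x (n + 1)))
    (hp : ∀ n, 0 < (p n).length) (n : ℕ) : n ≤ (concat p n).length := by
  induction n with
  | zero => simp
  | succ n ih =>
    have := hp n
    simp only [concat, Path.length_comp]
    lia

theorem arrows_concat_prefix {x : ℕ → V} (p : ∀ n, Path (x n) (x (n + 1))) {m n : ℕ} (h : m ≤ n) :
    arrows (concat p m) <+: arrows (concat p n) := by
  induction n, h using Nat.le_induction with
  | base => exact List.prefix_rfl
  | succ n _ ih =>
    refine ih.trans ?_
    rw [concat, arrows_comp]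
    exact List.prefix_append _ _

/-- A sequence of composable paths of positive length can be concatenated. -/
theorem exists_infinitePath_concat {x : ℕ → V} (p : ∀ n, Path (x n) (x (n + 1)))
    (hp : ∀ n, 0 < (p n).length) :
    ∃ ω : InfinitePath V,
      (∀ n, arrows (concat p n) = (List.range (concat p n).length).map ω.arrow) ∧
      ∀ n, ω.vertex (concat p n).length = x n := by
  have hlen : ∀ n k, k < n → k < (arrows (concat p n)).length := fun n k h => by
    rw [length_arrows]
    exact h.trans_le (le_length_concat p hp n)
  -- The first `k + 1` pieces have at least `k + 1` edges, so edge `k` can be read off there; by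
  -- `hf` any larger number of pieces gives the same edge.
  let f : ℕ → Total V := fun k => (arrows (concat p (k + 1)))[k]'(hlen _ _ k.lt_succ_self)
  have hf : ∀ n k (h : k < (arrows (concat p n)).length), (arrows (concat p n))[k] = f k := by
    intro n k h
    rcases le_total n (k + 1) with hn | hn
    · exact (arrows_concat_prefix p hn).getElem h
    · exact ((arrows_concat_prefix p hn).getElem _).symm
  have hchain : ∀ n, (f n).right = (f (n + 1)).left := by
    intro n
    have h := List.isChain_iff_getElem.1 (isChain_arrows (concat p (n + 2))) n
      (hlen _ _ (by lia))
    rwa [hf, hf] at h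
  refine ⟨InfinitePath.ofArrows f hchain, fun n => ?_, fun n => ?_⟩
  · refine List.ext_getElem (by simp) fun k h1 h2 => ?_
    rw [hf n k h1]
    simp [InfinitePath.arrow_ofArrows]
  · have h1 : (concat p n).length < (arrows (concat p (n + 1))).length := by
      have := hp n
      rw [length_arrows, concat, Path.length_comp]
      lia
    have h2 := hf (n + 1) _ h1
    change (f _).left = _
    rw [← h2]
    simp only [concat, arrows_comp]
    rw [List.getElem_append_right (by simp)]
    refine arrows_head? (p n) _ ?_
    simp only [length_arrows, Nat.sub_self]
    rw [List.head?_eq_getElem?]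
    exact List.getElem?_eq_getElem _

end Paths

/-! ### Aperiodic paths, double-cycles and terminal vertices. -/

section Aperiodic

variable {V : Type u} [Quiver.{v} V]

theorem map_range_prefix {α : Type*} (f : ℕ → α) {m n : ℕ} (h : m ≤ n) :
    (List.range m).map f <+: (List.range n).map f := by
  obtain ⟨k, rfl⟩ := Nat.exists_eq_add_of_le h
  rw [List.range_add, List.map_append]
  exact List.prefix_append _ _

theorem countable_total [Countable V] [∀ x y : V, Countable (x ⟶ y)] : Countable (Total V) := by
  have : Function.Injective
      (fun t : Total V => (⟨t.left, t.right, t.hom⟩ : Σ x y : V, x ⟶ y)) := by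
    rintro ⟨a, b, e⟩ ⟨a', b', e'⟩ h
    simp only [Sigma.mk.injEq] at h
    obtain ⟨rfl, h⟩ := h
    simp only [heq_eq_eq, Sigma.mk.injEq] at h
    obtain ⟨rfl, h⟩ := h
    rw [eq_of_heq h]
  exact this.countable

/-- For fixed `N` and `p` the sequence is determined by its first `N + p` terms. -/
theorem countable_eventuallyPeriodic (α : Type*) [Countable α] :
    {f : ℕ → α | ∃ N p : ℕ, 0 < p ∧ ∀ n, N ≤ n → f (n + p) = f n}.Countable := by
  have h : {f : ℕ → α | ∃ N p : ℕ, 0 < p ∧ ∀ n, N ≤ n → f (n + p) = f n} ⊆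
      ⋃ (N : ℕ) (p : ℕ), {f : ℕ → α | 0 < p ∧ ∀ n, N ≤ n → f (n + p) = f n} := by
    rintro f ⟨N, p, h⟩
    simp only [Set.mem_iUnion]
    exact ⟨N, p, h⟩
  refine Set.Countable.mono h (Set.countable_iUnion fun N => Set.countable_iUnion fun p => ?_)
  have hinj : Set.InjOn (fun (f : ℕ → α) (i : Fin (N + p)) => f i)
      {f : ℕ → α | 0 < p ∧ ∀ n, N ≤ n → f (n + p) = f n} := by
    rintro f ⟨hp, hf⟩ g ⟨-, hg⟩ hfg
    funext n
    induction n using Nat.strong_induction_on with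
    | _ n ih =>
      by_cases hn : n < N + p
      · exact congrFun hfg ⟨n, hn⟩
      · obtain ⟨m, rfl⟩ : ∃ m, n = m + p := ⟨n - p, by lia⟩
        rw [hf m (by lia), hg m (by lia), ih m (by lia)]
  exact Set.MapsTo.countable_of_injOn (Set.mapsTo_image _ _) hinj (Set.to_countable _)

/-- A graph with a double-cycle has an infinite path that is not eventually periodic. -/
theorem HasDoubleCycle.exists_not_isEventuallyPeriodic [Countable V]
    [∀ x y : V, Countable (x ⟶ y)] (h : HasDoubleCycle V) :
    ∃ ω : InfinitePath V, ¬ ω.IsEventuallyPeriodic := by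
  obtain ⟨x, c, d, hc, hd, hne⟩ := h
  by_contra! hall
  have := countable_total (V := V)
  let p : (ℕ → Bool) → ℕ → Path x x := fun s n => if s n then c else d
  have hp : ∀ s n, IsCycle (p s n) := fun s n => by
    simp only [p]; split_ifs <;> assumption
  have hex := fun s => exists_infinitePath_concat (x := fun _ => x) (p s) fun n => (hp s n).1
  choose ω hω _ using hex
  -- At the first index where `s` and `t` differ, the concatenations so far agree, so equal infinite
  -- paths would make one of `c`, `d` an initial segment of the other.
  have hinj : Function.Injective fun s => (ω s).arrow := by
    intro s t hst
    by_contra hne'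
    have hex : ∃ n, s n ≠ t n := Function.ne_iff.1 hne'
    classical
    have hj := Nat.find_spec hex
    set j := Nat.find hex
    have hconcat : ∀ i, i ≤ j →
        concat (x := fun _ => x) (p s) i = concat (x := fun _ => x) (p t) i := by
      intro i
      induction i with
      | zero => intro _; rfl
      | succ i ih =>
        intro hi
        have h1 : s i = t i := by
          by_contra h
          exact Nat.find_min hex (Nat.lt_of_succ_le hi) h
        simp only [concat]
        rw [ih (by lia)]
        simp only [p, h1]
    have key : ∀ s t : ℕ → Bool, (ω s).arrow = (ω t).arrow →
        concat (x := fun _ => x) (p s) j = concat (x := fun _ => x) (p t) j →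
        (p s j).length ≤ (p t j).length → p s j = p t j := by
      intro s t hst h hl
      have h1 : arrows (concat (x := fun _ => x) (p s) (j + 1)) <+:
          arrows (concat (x := fun _ => x) (p t) (j + 1)) := by
        rw [hω, hω, hst]
        apply map_range_prefix
        simp only [concat, Path.length_comp, h]
        lia
      simp only [concat, arrows_comp, h] at h1
      rw [List.prefix_append_right_inj] at h1
      obtain ⟨r, hr⟩ := exists_eq_comp_of_arrows_prefix _ _ h1
      exact (hp s j).eq_of_eq_comp (hp t j) hr
    have heq : p s j = p t j := by
      rcases le_total (p s j).length (p t j).length with hl | hl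
      · exact key s t hst (hconcat j le_rfl) hl
      · exact (key t s hst.symm (hconcat j le_rfl).symm hl).symm
    simp only [p] at heq
    cases hs : s j <;> cases ht : t j <;> simp_all
  have hcount : Countable (ℕ → Bool) := by
    rw [← Set.countable_univ_iff]
    exact Set.MapsTo.countable_of_injOn (f := fun s => (ω s).arrow) (fun s _ => hall (ω s))
      hinj.injOn (countable_eventuallyPeriodic (Total V))
  obtain ⟨g, hg⟩ := exists_injective_nat (ℕ → Bool)
  classical
  refine Function.cantor_injective (fun s : Set ℕ => g fun n => decide (n ∈ s)) ?_
  intro s t hst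
  have := hg hst
  ext n
  simpa using congrFun this n

/-- In a graph without double-cycles, an infinite path that returns to a vertex infinitely often is
eventually periodic. -/
theorem InfinitePath.isEventuallyPeriodic_of_infinite (h : ¬ HasDoubleCycle V) (ω : InfinitePath V)
    {x : V} (hx : {n | ω.vertex n = x}.Infinite) : ω.IsEventuallyPeriodic := by
  have hcyc : ∀ {a b : V} (w : Path a b), b = a → 0 < w.length →
      ∃ c r : Path a a, IsCycle c ∧ arrows w = arrows (c.comp r) := by
    rintro a b w rfl hw
    obtain ⟨c, r, hc, rfl⟩ := exists_isCycle_comp w hw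
    exact ⟨c, r, hc, rfl⟩
  -- The segment up to a later visit of `x` is closed, so from `t` on the path follows a full cycle.
  have hret : ∀ t, ω.vertex t = x → ∃ c : Path x x, IsCycle c ∧
      (∀ i (hi : i < c.length), ω.arrow (t + i) = (arrows c)[i]'(by simpa using hi)) ∧
        ω.vertex (t + c.length) = x := by
    rintro t rfl
    obtain ⟨t', ht', hlt⟩ := hx.exists_gt t
    obtain ⟨n, rfl⟩ := Nat.exists_eq_add_of_le hlt.le
    obtain ⟨c, r, hc, hcr⟩ := hcyc (ω.segment t n) ht' (by simp; lia)
    have hcn : c.length ≤ n := by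
      have := congrArg List.length hcr
      simp at this
      lia
    have harr : ∀ i (hi : i < c.length), ω.arrow (t + i) = (arrows c)[i]'(by simpa using hi) := by
      intro i hi
      have h1 : i < (arrows (ω.segment t n)).length := by simp; lia
      have h2 : (arrows (ω.segment t n))[i] = ω.arrow (t + i) := by
        simp [arrows_segment]
      rw [← h2]
      simp only [hcr, arrows_comp]
      rw [List.getElem_append_left]
    refine ⟨c, hc, harr, ?_⟩
    have hpos := hc.1
    obtain ⟨k, hk⟩ : ∃ k, c.length = k + 1 := ⟨c.length - 1, by lia⟩
    have h3 := congrArg Total.right (harr k (by lia))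
    rw [hk]
    refine h3.trans (arrows_getLast? c _ ?_)
    have hk' : (arrows c).length - 1 = k := by simp [hk]
    rw [Option.mem_def, List.getLast?_eq_getElem?, List.getElem?_eq_some_iff]
    exact ⟨by simp [hk], by simp only [hk']⟩
  obtain ⟨t, ht, -⟩ := hx.exists_gt 0
  obtain ⟨c, hc, -, -⟩ := hret t ht
  -- Without double-cycles, the cycle followed is the same at every visit.
  have hret' : ∀ t, ω.vertex t = x →
      (∀ i (hi : i < c.length), ω.arrow (t + i) = (arrows c)[i]'(by simpa using hi)) ∧
        ω.vertex (t + c.length) = x := by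
    intro t ht
    obtain ⟨d, hd, h1, h2⟩ := hret t ht
    obtain rfl : d = c := by
      by_contra hne
      exact h ⟨x, d, c, hd, hc, hne⟩
    exact ⟨h1, h2⟩
  have hmul : ∀ m, ω.vertex (t + m * c.length) = x := by
    intro m
    induction m with
    | zero => simpa using ht
    | succ m ih => rw [Nat.succ_mul, ← Nat.add_assoc]; exact (hret' _ ih).2
  refine ⟨t, c.length, hc.1, fun n hn => ?_⟩
  obtain ⟨k, rfl⟩ := Nat.exists_eq_add_of_le hn
  have hlt := Nat.mod_lt k hc.1
  have h1 := (hret' _ (hmul (k / c.length))).1 _ hlt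
  have h2 := (hret' _ (hmul (k / c.length + 1))).1 _ hlt
  have hk := Nat.div_add_mod k c.length
  have e1 : t + k / c.length * c.length + k % c.length = t + k := by
    rw [Nat.mul_comm]; lia
  have e2 : t + (k / c.length + 1) * c.length + k % c.length = t + k + c.length := by
    rw [Nat.add_mul, Nat.mul_comm (k / c.length)]; lia
  rw [e1] at h1
  rw [e2] at h2
  rw [h1, h2]

/-- In a graph without double-cycles, an infinite path that is not eventually periodic can be
shortened to one that visits no vertex twice. -/
theorem exists_injective_vertex (h : ¬ HasDoubleCycle V) (ω : InfinitePath V)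
    (hω : ¬ ω.IsEventuallyPeriodic) : ∃ ω' : InfinitePath V, Function.Injective ω'.vertex := by
  have hlast : ∀ i, ∃ m, ω.vertex m = ω.vertex i ∧ ∀ n, ω.vertex n = ω.vertex i → n ≤ m := by
    intro i
    have hfin : {n | ω.vertex n = ω.vertex i}.Finite := by
      by_contra hinf
      exact hω (ω.isEventuallyPeriodic_of_infinite h hinf)
    obtain ⟨m, hm, hmax⟩ := hfin.exists_maximalFor id _ ⟨i, rfl⟩
    refine ⟨m, hm, fun n hn => ?_⟩
    by_contra hlt
    exact hlt (hmax hn (le_of_not_ge hlt))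
  choose l hl hl' using hlast
  -- Start at the last visit to the initial vertex; then repeatedly take one edge and jump to the
  -- last visit to the vertex reached.
  let t : ℕ → ℕ := fun n => Nat.rec (l 0) (fun _ k => l (k + 1)) n
  have hvert : ∀ n, ω.vertex (t n + 1) = ω.vertex (t (n + 1)) := fun n => (hl _).symm
  have hmono : StrictMono t := strictMono_nat_of_lt_succ fun n => hl' _ _ rfl
  have hmax : ∀ n k, ω.vertex k = ω.vertex (t n) → k ≤ t n := by
    rintro (_ | n) k hk
    · exact hl' 0 k (hk.trans (hl 0))
    · exact hl' _ k (hk.trans (hl _))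
  refine ⟨⟨fun n => ω.vertex (t n), fun n => hvert n ▸ ω.edge (t n)⟩, fun m n hmn => ?_⟩
  exact hmono.injective (le_antisymm (hmax n _ hmn) (hmax m _ hmn.symm))

/-- If all infinite paths are eventually periodic, then each nonempty set of vertices contains a
vertex that can be reached again from all vertices of the set that can be reached from it. -/
theorem exists_terminal (h : ∀ ω : InfinitePath V, ω.IsEventuallyPeriodic) {X : Set V}
    (hX : X.Nonempty) :
    ∃ x ∈ X, ∀ y ∈ X, Nonempty (Path x y) → Nonempty (Path y x) := by
  by_contra! hcon
  have hcon' : ∀ x : X, ∃ y : X, Nonempty (Path x.1 y.1) ∧ IsEmpty (Path y.1 x.1) := by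
    rintro ⟨x, hx⟩
    obtain ⟨y, hy, h1, h2⟩ := hcon x hx
    exact ⟨⟨y, hy⟩, h1, h2⟩
  choose next hnext hno using hcon'
  -- Otherwise there is a chain of vertices, each reachable from its predecessor but with no way
  -- back. The concatenated infinite path is eventually periodic, hence does return.
  let x : ℕ → X := fun n => next^[n] ⟨_, hX.some_mem⟩
  have hx : ∀ n, x (n + 1) = next (x n) := fun n => Function.iterate_succ_apply' _ _ _
  have hpath : ∀ n, Nonempty (Path (x n).1 (x (n + 1)).1) := fun n => by rw [hx]; exact hnext _
  have hno' : ∀ n, IsEmpty (Path (x (n + 1)).1 (x n).1) := fun n => by rw [hx]; exact hno _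
  let p : ∀ n, Path (x n).1 (x (n + 1)).1 := fun n => (hpath n).some
  have hp : ∀ n, 0 < (p n).length := by
    intro n
    by_contra h0
    have heq := Path.eq_of_length_zero (p n) (by lia)
    refine (hno' n).false ?_
    rw [← heq]
    exact .nil
  obtain ⟨ω, -, hω⟩ := exists_infinitePath_concat (x := fun n => (x n).1) p hp
  obtain ⟨N, q, hq, hper⟩ := h ω
  set s := (concat (x := fun n => (x n).1) p N).length with hs
  set s' := (concat (x := fun n => (x n).1) p (N + 1)).length with hs'
  have hNs : N ≤ s := le_length_concat (x := fun n => (x n).1) p hp N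
  have hmul : ∀ m, ω.vertex (s + m * q) = x N := by
    intro m
    induction m with
    | zero => simpa using hω N
    | succ m ih =>
      rw [Nat.succ_mul, ← Nat.add_assoc, ← ih]
      exact congrArg Total.left (hper _ (by lia))
  -- After `s'` further periods the path is again at `x N`, and this happens no earlier than its
  -- passage through `x (N + 1)`.
  have hle : s' ≤ s + s' * q := (Nat.le_mul_of_pos_right s' hq).trans (Nat.le_add_left _ _)
  have := ω.nonempty_path hle
  rw [hmul, hω (N + 1)] at this
  exact (not_nonempty_iff.2 (hno' N)) this

end Aperiodic

/-! ### Operators that permute the standard basis partially -/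

section PartialMap

variable {ι ι' κ : Type*}

/-- The partial isometry `ℓ²(ι) → ℓ²(ι')` that sends the basis vector of `f k` to the basis vector
of `g k` and the basis vectors outside of the range of `f` to `0`. -/
noncomputable def partialMap (f : κ ↪ ι) (g : κ ↪ ι') : EllTwo ι →L[ℂ] EllTwo ι' :=
  (basisIsometry g).toContinuousLinearMap ∘L
    ContinuousLinearMap.adjoint (basisIsometry f).toContinuousLinearMap

theorem inner_stdBasis [DecidableEq ι] (i j : ι) :
    ⟪stdBasis ι i, stdBasis ι j⟫_ℂ = if i = j then 1 else 0 :=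
  orthonormal_iff_ite.1 (stdBasis ι).orthonormal i j

theorem inner_stdBasis_self (i : ι) : ⟪stdBasis ι i, stdBasis ι i⟫_ℂ = 1 := by
  classical
  rw [inner_stdBasis, if_pos rfl]

theorem inner_stdBasis_of_ne {i j : ι} (h : i ≠ j) : ⟪stdBasis ι i, stdBasis ι j⟫_ℂ = 0 :=
  (stdBasis ι).orthonormal.2 h

theorem stdBasis_ne_zero (i : ι) : stdBasis ι i ≠ 0 := (stdBasis ι).orthonormal.ne_zero i

theorem ext_inner_stdBasis {a b : EllTwo ι}
    (h : ∀ i, ⟪stdBasis ι i, a⟫_ℂ = ⟪stdBasis ι i, b⟫_ℂ) : a = b := by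
  refine (stdBasis ι).repr.injective ?_
  ext i
  rw [HilbertBasis.repr_apply_apply, HilbertBasis.repr_apply_apply, h]

theorem clm_ext_stdBasis {E : Type*} [NormedAddCommGroup E] [NormedSpace ℂ E]
    {A B : EllTwo ι →L[ℂ] E} (h : ∀ i, A (stdBasis ι i) = B (stdBasis ι i)) : A = B := by
  refine ContinuousLinearMap.ext_on
    (Submodule.dense_iff_topologicalClosure_eq_top.2 (stdBasis ι).dense_span) ?_
  rintro _ ⟨i, rfl⟩
  exact h i

theorem adjoint_basisIsometry_comp (f : κ ↪ ι) :
    ContinuousLinearMap.adjoint (basisIsometry f).toContinuousLinearMap ∘L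
      (basisIsometry f).toContinuousLinearMap = 1 :=
  (ContinuousLinearMap.norm_map_iff_adjoint_comp_self _).1 (basisIsometry f).norm_map

theorem adjoint_basisIsometry_apply (f : κ ↪ ι) (k : κ) :
    ContinuousLinearMap.adjoint (basisIsometry f).toContinuousLinearMap (stdBasis ι (f k)) =
      stdBasis κ k := by
  rw [← basisIsometry_apply]
  exact ContinuousLinearMap.ext_iff.1 (adjoint_basisIsometry_comp f) (stdBasis κ k)

theorem adjoint_basisIsometry_apply_of_notMem (f : κ ↪ ι) {i : ι} (hi : i ∉ Set.range f) :
    ContinuousLinearMap.adjoint (basisIsometry f).toContinuousLinearMap (stdBasis ι i) = 0 := by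
  refine ext_inner_stdBasis fun k => ?_
  rw [ContinuousLinearMap.adjoint_inner_right, inner_zero_right]
  refine Eq.trans (congrArg (fun a => ⟪a, stdBasis ι i⟫_ℂ) (basisIsometry_apply f k)) ?_
  exact inner_stdBasis_of_ne fun h => hi ⟨k, h⟩

theorem partialMap_apply (f : κ ↪ ι) (g : κ ↪ ι') (k : κ) :
    partialMap f g (stdBasis ι (f k)) = stdBasis ι' (g k) := by
  rw [partialMap, ContinuousLinearMap.comp_apply, adjoint_basisIsometry_apply]
  exact basisIsometry_apply g k

theorem partialMap_apply_of_notMem (f : κ ↪ ι) (g : κ ↪ ι') {i : ι} (hi : i ∉ Set.range f) :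
    partialMap f g (stdBasis ι i) = 0 := by
  rw [partialMap, ContinuousLinearMap.comp_apply, adjoint_basisIsometry_apply_of_notMem f hi,
    map_zero]

theorem adjoint_partialMap (f : κ ↪ ι) (g : κ ↪ ι') :
    ContinuousLinearMap.adjoint (partialMap f g) = partialMap g f := by
  rw [partialMap, ContinuousLinearMap.adjoint_comp, ContinuousLinearMap.adjoint_adjoint, partialMap]

theorem star_partialMap (f g : κ ↪ ι) : star (partialMap f g) = partialMap g f := by
  rw [ContinuousLinearMap.star_eq_adjoint, adjoint_partialMap]

theorem hasSum_partialMap (f : κ ↪ ι) (g : κ ↪ ι') (a : EllTwo ι) :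
    HasSum (fun k => (stdBasis ι).repr a (f k) • stdBasis ι' (g k)) (partialMap f g a) := by
  have h := ((stdBasis ι).hasSum_repr a).mapL (partialMap f g)
  rw [← Function.Injective.hasSum_iff f.injective] at h
  · convert h using 2 with k
    simp [partialMap_apply]
  · intro i hi
    rw [map_smul, partialMap_apply_of_notMem f g hi, smul_zero]

theorem hasSum_partialMap_sigma {σ : κ → Type*} (f : (Σ k, σ k) ↪ ι) (g : (Σ k, σ k) ↪ ι')
    (a : EllTwo ι) :
    HasSum (fun k => partialMap ((Function.Embedding.sigmaMk k).trans f)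
      ((Function.Embedding.sigmaMk k).trans g) a) (partialMap f g a) := by
  have h1 : ∀ k, HasSum (fun c : σ k => (stdBasis ι).repr a (f ⟨k, c⟩) • stdBasis ι' (g ⟨k, c⟩))
      (partialMap ((Function.Embedding.sigmaMk k).trans f)
        ((Function.Embedding.sigmaMk k).trans g) a) := fun k =>
    hasSum_partialMap ((Function.Embedding.sigmaMk k).trans f)
      ((Function.Embedding.sigmaMk k).trans g) a
  exact HasSum.sigma (hasSum_partialMap f g a) h1

end PartialMap

/-! ### Weak operator topology -/

section WOT

variable {H : Type*} [NormedAddCommGroup H] [InnerProductSpace ℂ H]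

theorem subset_wotAlg (S : Set (H →L[ℂ] H)) : S ⊆ wotAlg S := by
  intro T hT
  rw [wotAlg, SetLike.mem_coe, NonUnitalAlgebra.mem_sInf]
  exact fun A hA => hA.2 hT

theorem isWOTClosed_wotAlg (S : Set (H →L[ℂ] H)) : IsWOTClosed (wotAlg S : Set (H →L[ℂ] H)) := by
  have : {T : H →WOT[ℂ] H | T.toCLM ∈ (wotAlg S : Set (H →L[ℂ] H))} =
      ⋂ A ∈ {A : NonUnitalSubalgebra ℂ (H →L[ℂ] H) |
        IsWOTClosed (A : Set (H →L[ℂ] H)) ∧ S ⊆ A}, {T : H →WOT[ℂ] H | T.toCLM ∈ A} := by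
    ext T
    simp [wotAlg]
  rw [IsWOTClosed, this]
  exact isClosed_biInter fun A hA => hA.1

theorem wotAlg_le {S : Set (H →L[ℂ] H)} {A : NonUnitalSubalgebra ℂ (H →L[ℂ] H)}
    (hA : IsWOTClosed (A : Set (H →L[ℂ] H))) (hS : S ⊆ A) : wotAlg S ≤ A :=
  sInf_le ⟨hA, hS⟩

theorem IsWOTClosed.mem_of_tendsto [CompleteSpace H] {S : Set (H →L[ℂ] H)} (hS : IsWOTClosed S)
    {α : Type*} {l : Filter α} [l.NeBot] {T : α → H →L[ℂ] H} {A : H →L[ℂ] H} (hT : ∀ a, T a ∈ S)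
    (h : ∀ x, Tendsto (fun a => T a x) l (𝓝 (A x))) : A ∈ S := by
  have h1 : Tendsto (fun a => ContinuousLinearMapWOT.ofCLM (σ := RingHom.id ℂ) (T a)) l
      (𝓝 (ContinuousLinearMapWOT.ofCLM A)) := by
    rw [ContinuousLinearMapWOT.tendsto_iff_forall_inner_apply_tendsto]
    intro x y
    exact (innerSL ℂ y).continuous.continuousAt.tendsto.comp (h x)
  have hS' : IsClosed {T : H →WOT[ℂ] H | T.toCLM ∈ S} := hS
  exact hS'.mem_of_tendsto h1 (Eventually.of_forall hT)

/-- Compression by two fixed operators is continuous in the weak operator topology. -/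
theorem continuous_wot_comp {H' : Type*} [NormedAddCommGroup H'] [InnerProductSpace ℂ H']
    [CompleteSpace H] [CompleteSpace H'] (B : H' →L[ℂ] H) (C : H →L[ℂ] H') :
    Continuous fun T : H →WOT[ℂ] H =>
      ContinuousLinearMapWOT.ofCLM (σ := RingHom.id ℂ) (C ∘L T.toCLM ∘L B) := by
  rw [ContinuousLinearMapWOT.continuous_iff]
  intro x y
  have : ∀ T : H →WOT[ℂ] H, ⟪y, ContinuousLinearMapWOT.ofCLM (σ := RingHom.id ℂ)
      (C ∘L T.toCLM ∘L B) x⟫_ℂ = ⟪ContinuousLinearMap.adjoint C y, T (B x)⟫_ℂ := by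
    intro T
    rw [ContinuousLinearMap.adjoint_inner_left]
    rfl
  simp only [this]
  exact ContinuousLinearMapWOT.continuous_inner_apply continuous_id _ _

/-- Commuting with a fixed operator equates two WOT-continuous functions. -/
theorem isWOTClosed_centralizer [CompleteSpace H] (S : Set (H →L[ℂ] H)) :
    IsWOTClosed (NonUnitalSubalgebra.centralizer ℂ S : Set (H →L[ℂ] H)) := by
  have : {T : H →WOT[ℂ] H | T.toCLM ∈
      (NonUnitalSubalgebra.centralizer ℂ S : Set (H →L[ℂ] H))} =
      ⋂ R ∈ S, {T : H →WOT[ℂ] H | ContinuousLinearMapWOT.ofCLM (σ := RingHom.id ℂ)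
        (R ∘L T.toCLM ∘L ContinuousLinearMap.id ℂ H) = ContinuousLinearMapWOT.ofCLM
        (ContinuousLinearMap.id ℂ H ∘L T.toCLM ∘L R)} := by
    ext T
    simp only [Set.mem_ofPred_eq, Set.mem_iInter, SetLike.mem_coe,
      NonUnitalSubalgebra.mem_centralizer_iff, ContinuousLinearMapWOT.ofCLM_injective.eq_iff]
    rfl
  rw [IsWOTClosed, this]
  exact isClosed_biInter fun R _ =>
    isClosed_eq (continuous_wot_comp _ _) (continuous_wot_comp _ _)

theorem commute_of_mem_wotAlg [CompleteSpace H] {S : Set (H →L[ℂ] H)} {R T : H →L[ℂ] H}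
    (hS : ∀ A ∈ S, R * A = A * R) (hT : T ∈ wotAlg S) : R * T = T * R := by
  have h := wotAlg_le (isWOTClosed_centralizer {R}) (S := S) (fun A hA => by
    rw [SetLike.mem_coe, NonUnitalSubalgebra.mem_centralizer_iff]
    rintro _ rfl
    exact hS A hA) hT
  exact (NonUnitalSubalgebra.mem_centralizer_iff ℂ).1 h R rfl

/-- The finite sums of the blocks converge strongly to the whole operator. This brings sums over
infinitely many vertices into the algebra. -/
theorem partialMap_mem_of_isWOTClosed {ι κ : Type*} {σ : κ → Type*} (f g : (Σ k, σ k) ↪ ι)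
    {A : NonUnitalSubalgebra ℂ (EllTwo ι →L[ℂ] EllTwo ι)}
    (hA : IsWOTClosed (A : Set (EllTwo ι →L[ℂ] EllTwo ι)))
    (h : ∀ k, partialMap ((Function.Embedding.sigmaMk k).trans f)
      ((Function.Embedding.sigmaMk k).trans g) ∈ A) : partialMap f g ∈ A := by
  refine hA.mem_of_tendsto (l := atTop) (T := fun s : Finset κ => ∑ k ∈ s,
    partialMap ((Function.Embedding.sigmaMk k).trans f) ((Function.Embedding.sigmaMk k).trans g))
    (fun s => sum_mem fun k _ => h k) fun a => ?_
  have h := hasSum_partialMap_sigma f g a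
  rw [HasSum, SummationFilter.unconditional_filter] at h
  simpa only [sum_apply] using h

end WOT

/-! ### Left and right creation operators -/

section Creation

variable {V : Type u} [Quiver.{v} V]

theorem creation_eq_partialMap {x y : V} (p : Path x y) :
    creation p = partialMap (pathsTo x) (followBy p) := rfl

theorem creation_cons {x y z : V} (p : Path x y) (e : y ⟶ z) :
    creation (p.cons e) = creation e.toPath * creation p := by
  refine clm_ext_stdBasis ?_
  rintro ⟨a, b, w⟩
  change creation _ (ξ _) = creation _ (creation _ (ξ _))
  by_cases h : b = x
  · subst h
    rw [creation_apply, creation_apply, creation_apply]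
    rfl
  · rw [creation_apply_of_ne _ _ h, creation_apply_of_ne _ _ h, map_zero]

theorem creation_nil_mem (x : V) :
    creation (Path.nil : Path x x) ∈ freeSemigroupoidAlgebra V :=
  subset_wotAlg _ (Or.inl ⟨x, rfl⟩)

theorem creation_mem {x y : V} (p : Path x y) : creation p ∈ freeSemigroupoidAlgebra V := by
  induction p with
  | nil => exact creation_nil_mem x
  | cons p e ih =>
    rw [creation_cons]
    exact mul_mem (subset_wotAlg _ (Or.inr ⟨_, _, e, rfl⟩)) ih

/-- The paths with initial vertex `x`, as elements of the free semigroupoid. -/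
def pathsFrom (x : V) : (Σ z : V, Path x z) ↪ FreeSemigroupoid V where
  toFun w := ⟨x, w.1, w.2⟩
  inj' := by
    rintro ⟨z, w⟩ ⟨z', w'⟩ h
    simpa using h

/-- The map `w ↦ wp` on the paths `w` whose initial vertex is the final vertex of `p`. -/
def precedeBy {x y : V} (p : Path x y) : (Σ z : V, Path y z) ↪ FreeSemigroupoid V where
  toFun w := ⟨x, w.1, p.comp w.2⟩
  inj' := by
    rintro ⟨z, w⟩ ⟨z', w'⟩ h
    simp only [Sigma.mk.injEq, heq_eq_eq, true_and] at h
    obtain ⟨rfl, h⟩ := h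
    simpa using h

/-- The right creation operator of a path `p`: it sends `ξ_w` to `ξ_{wp}` if `wp` is a path, and
to `0` otherwise. -/
noncomputable def rightCreation {x y : V} (p : Path x y) : Fock V →L[ℂ] Fock V :=
  partialMap (pathsFrom y) (precedeBy p)

theorem rightCreation_apply {x y z : V} (p : Path x y) (w : Path y z) :
    rightCreation p (ξ ⟨y, z, w⟩) = ξ ⟨x, z, p.comp w⟩ :=
  partialMap_apply (pathsFrom y) (precedeBy p) ⟨z, w⟩

theorem rightCreation_apply_of_ne {x y y' z : V} (p : Path x y) (w : Path y' z) (h : y' ≠ y) :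
    rightCreation p (ξ ⟨y', z, w⟩) = 0 := by
  refine partialMap_apply_of_notMem _ _ ?_
  rintro ⟨k, hk⟩
  exact h (congrArg Sigma.fst hk).symm

theorem star_rightCreation {x y : V} (p : Path x y) :
    star (rightCreation p) = partialMap (precedeBy p) (pathsFrom y) := star_partialMap _ _

theorem star_rightCreation_apply {x y z : V} (p : Path x y) (w : Path y z) :
    star (rightCreation p) (ξ ⟨x, z, p.comp w⟩) = ξ ⟨y, z, w⟩ := by
  rw [star_rightCreation]
  exact partialMap_apply (precedeBy p) (pathsFrom y) ⟨z, w⟩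

theorem rightCreation_mul_creation {x y a b : V} (p : Path x y) (q : Path a b) :
    rightCreation p * creation q = creation q * rightCreation p := by
  refine clm_ext_stdBasis ?_
  rintro ⟨c, d, w⟩
  change rightCreation p (creation q (ξ _)) = creation q (rightCreation p (ξ _))
  by_cases hd : d = a
  · subst hd
    rw [creation_apply]
    by_cases hc : c = y
    · subst hc
      rw [rightCreation_apply, rightCreation_apply, creation_apply, Path.comp_assoc]
    · rw [rightCreation_apply_of_ne _ _ hc, rightCreation_apply_of_ne _ _ hc, map_zero]
  · rw [creation_apply_of_ne _ _ hd, map_zero]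
    by_cases hc : c = y
    · subst hc
      rw [rightCreation_apply, creation_apply_of_ne _ _ hd]
    · rw [rightCreation_apply_of_ne _ _ hc, map_zero]

/-- The free semigroupoid algebra commutes with the right creation operators. -/
theorem rightCreation_mul_comm {x y : V} (p : Path x y) {T : Fock V →L[ℂ] Fock V}
    (hT : T ∈ freeSemigroupoidAlgebra V) : rightCreation p * T = T * rightCreation p := by
  refine commute_of_mem_wotAlg ?_ hT
  rintro _ (⟨z, rfl⟩ | ⟨z, z', e, rfl⟩) <;> exact rightCreation_mul_creation _ _

end Creation

/-! ### Initial projections of partial isometries in the free semigroupoid algebra -/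

section Structure

variable {V : Type u} [Quiver.{v} V]

theorem star_rightCreation_mul_rightCreation {x y : V} (p : Path x y) :
    star (rightCreation p) * rightCreation p = rightCreation (Path.nil : Path y y) := by
  refine clm_ext_stdBasis ?_
  rintro ⟨a, b, w⟩
  change star (rightCreation p) (rightCreation p (ξ _)) = rightCreation _ (ξ _)
  by_cases h : a = y
  · subst h
    rw [rightCreation_apply, star_rightCreation_apply, rightCreation_apply, Path.nil_comp]
  · rw [rightCreation_apply_of_ne _ _ h, rightCreation_apply_of_ne _ _ h, map_zero]

theorem star_rightCreation_apply_nil {a b x : V} (w : Path a b)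
    (h : (⟨a, b, w⟩ : FreeSemigroupoid V) ≠ ⟨x, x, .nil⟩) :
    star (rightCreation w) (ξ ⟨x, x, .nil⟩) = 0 := by
  rw [star_rightCreation]
  refine partialMap_apply_of_notMem _ _ ?_
  rintro ⟨⟨z, w'⟩, hk⟩
  change (⟨a, z, w.comp w'⟩ : FreeSemigroupoid V) = ⟨x, x, .nil⟩ at hk
  simp only [Sigma.mk.injEq] at hk
  obtain ⟨rfl, hk⟩ := hk
  simp only [heq_eq_eq, Sigma.mk.injEq] at hk
  obtain ⟨rfl, hk⟩ := hk
  have h0 := congrArg Path.length (eq_of_heq hk)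
  simp only [Path.length_comp, Path.length_nil] at h0
  have hb := Path.eq_of_length_zero w (by lia)
  subst hb
  rw [Path.eq_nil_of_length_zero w (by lia)] at h
  exact h rfl

variable {U : Fock V →L[ℂ] Fock V}

theorem IsPartialIsometry.mul_self (hU : IsPartialIsometry U) :
    star U * U * (star U * U) = star U * U := by
  rw [mul_assoc, ← mul_assoc U, show U * star U * U = U from hU]

/-- The initial projection of a partial isometry in the free semigroupoid algebra commutes with the
right creation operators. -/
theorem IsPartialIsometry.star_mul_self_comm (hU : IsPartialIsometry U)
    (hmem : U ∈ freeSemigroupoidAlgebra V) {x y : V} (p : Path x y) :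
    star U * U * rightCreation p = rightCreation p * (star U * U) := by
  have hRU := rightCreation_mul_comm p hmem
  have hQU := rightCreation_mul_comm (Path.nil : Path y y) hmem
  have hQ := star_rightCreation_mul_rightCreation p
  have hPP := hU.mul_self
  set R := rightCreation p
  set Q := rightCreation (Path.nil : Path y y)
  have hQs : star Q = Q := by rw [← hQ, star_mul, star_star]
  have hQU' : star U * Q = Q * star U := by
    have := congrArg star hQU
    rwa [star_mul, star_mul, hQs] at this
  set P := star U * U with hP
  have hPs : star P = P := by rw [hP, star_mul, star_star]
  have hPQ : Q * P = P * Q := by rw [hP, ← mul_assoc, ← hQU', mul_assoc, hQU, mul_assoc]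
  -- Since `U R = R U`, the compression `R* P R` equals `U* (R* R) U`, and `U` commutes with `R* R =
  -- Q`.
  have hX : star R * P * R = P * Q := by
    calc star R * P * R = star (U * R) * (U * R) := by
          rw [hP, star_mul]; simp only [mul_assoc]
      _ = star U * (star R * R) * U := by
          rw [← hRU, star_mul]; simp only [mul_assoc]
      _ = P * Q := by rw [hQ, mul_assoc, hQU, hP, mul_assoc]
  -- Only `R` is known to commute with `U`, not `R*`; so the commutator `C` is shown to vanish
  -- through `C* C = 0`, whose four terms all reduce to `± P Q`.
  have hC : star (P * R - R * P) * (P * R - R * P) = 0 := by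
    have h1 : star (P * R - R * P) * (P * R - R * P) =
        star R * (P * P) * R - star R * P * R * P - P * (star R * P * R) +
          P * (star R * R) * P := by
      rw [star_sub, star_mul P R, star_mul R P, hPs]
      noncomm_ring
    have h2 : P * Q * P = P * Q := by rw [mul_assoc, hPQ, ← mul_assoc, hPP]
    have h3 : P * (P * Q) = P * Q := by rw [← mul_assoc, hPP]
    rw [h1, hPP, hX, hQ, h2, h3]
    simp
  exact sub_eq_zero.1 ((CStarRing.star_mul_self_eq_zero_iff _).1 hC)

/-- The initial projection of a partial isometry in the free semigroupoid algebra is the projection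
onto the span of the paths with final vertex in some set. -/
theorem IsPartialIsometry.exists_initial_vertices (hU : IsPartialIsometry U)
    (hmem : U ∈ freeSemigroupoidAlgebra V) :
    ∃ X : Set V, ∀ w : FreeSemigroupoid V,
      (w.2.1 ∈ X → (star U * U) (ξ w) = ξ w) ∧ (w.2.1 ∉ X → (star U * U) (ξ w) = 0) := by
  have hcomm := fun {x y : V} (p : Path x y) => hU.star_mul_self_comm hmem p
  have hPP := hU.mul_self
  set P := star U * U with hP
  have hPs : star P = P := by rw [hP, star_mul, star_star]
  have hcomm' : ∀ {x y : V} (p : Path x y), star (rightCreation p) * P =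
      P * star (rightCreation p) := by
    intro x y p
    have := congrArg star (hcomm p)
    rwa [star_mul P, star_mul _ P, hPs] at this
  -- Every `ξ_w` is `R_w` applied to the vertex vector of its final vertex, and `P` commutes with
  -- `R_w*`, which kills `ξ_x` unless `w` is the trivial path at `x`. So `ξ_x` is an eigenvector of
  -- `P`; idempotence leaves the eigenvalues `0` and `1`.
  have hdiag : ∀ x : V, ∃ c : ℂ, P (ξ ⟨x, x, .nil⟩) = c • ξ ⟨x, x, .nil⟩ := by
    intro x
    refine ⟨⟪ξ ⟨x, x, .nil⟩, P (ξ ⟨x, x, .nil⟩)⟫_ℂ, ext_inner_stdBasis ?_⟩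
    rintro ⟨a, b, w⟩
    change ⟪ξ _, _⟫_ℂ = ⟪ξ _, _⟫_ℂ
    by_cases h : (⟨a, b, w⟩ : FreeSemigroupoid V) = ⟨x, x, .nil⟩
    · rw [h, inner_smul_right]
      erw [inner_stdBasis_self]
      rw [mul_one]
    · rw [inner_smul_right]
      erw [inner_stdBasis_of_ne h]
      rw [mul_zero]
      have h1 : ξ ⟨a, b, w⟩ = rightCreation w (ξ ⟨b, b, .nil⟩) := by
        rw [rightCreation_apply, Path.comp_nil]
      change ⟪ξ _, _⟫_ℂ = _
      rw [h1, ← ContinuousLinearMap.adjoint_inner_right, ← ContinuousLinearMap.star_eq_adjoint]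
      have h2 := ContinuousLinearMap.ext_iff.1 (hcomm' w) (ξ ⟨x, x, .nil⟩)
      change star (rightCreation w) (P _) = P (star (rightCreation w) _) at h2
      rw [h2, star_rightCreation_apply_nil w h, map_zero, inner_zero_right]
  have hext : ∀ {a b : V} (w : Path a b), P (ξ ⟨a, b, w⟩) =
      rightCreation w (P (ξ ⟨b, b, .nil⟩)) := by
    intro a b w
    have h2 := ContinuousLinearMap.ext_iff.1 (hcomm w) (ξ ⟨b, b, .nil⟩)
    change P (rightCreation w _) = rightCreation w (P _) at h2
    rw [← h2, rightCreation_apply, Path.comp_nil]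
  refine ⟨{x | P (ξ ⟨x, x, .nil⟩) = ξ ⟨x, x, .nil⟩}, ?_⟩
  rintro ⟨a, b, w⟩
  refine ⟨fun h => ?_, fun h => ?_⟩
  · rw [hext, show P (ξ ⟨b, b, .nil⟩) = ξ ⟨b, b, .nil⟩ from h, rightCreation_apply, Path.comp_nil]
  · obtain ⟨c, hc⟩ := hdiag b
    have h2 := ContinuousLinearMap.ext_iff.1 hPP (ξ ⟨b, b, .nil⟩)
    change P (P _) = P _ at h2
    rw [hc, map_smul, hc, smul_smul] at h2
    have h3 := smul_left_injective ℂ (stdBasis_ne_zero (ι := FreeSemigroupoid V) ⟨b, b, .nil⟩) h2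
    have h4 : c = 0 ∨ c = 1 := by
      rcases eq_or_ne c 0 with h0 | h0
      · exact Or.inl h0
      · exact Or.inr (mul_left_cancel₀ h0 (h3.trans (mul_one c).symm))
    rcases h4 with rfl | rfl
    · rw [hext, hc, zero_smul, map_zero]
    · exact absurd (by rw [hc, one_smul] : P (ξ ⟨b, b, .nil⟩) = ξ ⟨b, b, .nil⟩) h

end Structure

/-! ### A count of wandering vectors -/

/-- If two orthonormal systems are shifted by the same isometry and the second one generates a
space that contains the first one, then the first one has at most as many generators. -/
theorem card_le_card_of_shift {H : Type*} [NormedAddCommGroup H] [InnerProductSpace ℂ H]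
    {A B : Type*} [Fintype A] [Fintype B] {e : A × ℕ → H} {f : B × ℕ → H}
    (he : Orthonormal ℂ e) (hf : ∀ j, ‖f j‖ = 1)
    (hsum : ∀ a, HasSum (fun j => ‖⟪f j, e (a, 0)⟫_ℂ‖ ^ 2) 1)
    (hshift : ∀ a b m n, ⟪f (b, n + 1), e (a, m + 1)⟫_ℂ = ⟪f (b, n), e (a, m)⟫_ℂ) :
    Fintype.card A ≤ Fintype.card B := by
  classical
  have hshift' : ∀ a b m n k, ⟪f (b, n + k), e (a, m + k)⟫_ℂ = ⟪f (b, n), e (a, m)⟫_ℂ := by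
    intro a b m n k
    induction k with
    | zero => rfl
    | succ k ih => rw [← Nat.add_assoc, ← Nat.add_assoc, hshift, ih]
  -- Shifting turns the pairing of `f (b, n)` with `e (a, 0)` into that of `f (b, N - 1)` with `e
  -- (a, N - 1 - n)`. All terms are thus coefficients of one unit vector, and Bessel's inequality
  -- applies.
  have hbound : ∀ (N : ℕ) (b : B),
      ∑ n ∈ Finset.range N, ∑ a, ‖⟪f (b, n), e (a, 0)⟫_ℂ‖ ^ 2 ≤ 1 := by
    intro N b
    have h1 : ∑ n ∈ Finset.range N, ∑ a, ‖⟪f (b, n), e (a, 0)⟫_ℂ‖ ^ 2 =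
        ∑ n ∈ Finset.range N, ∑ a, ‖⟪f (b, N - 1), e (a, N - 1 - n)⟫_ℂ‖ ^ 2 := by
      refine Finset.sum_congr rfl fun n hn => Finset.sum_congr rfl fun a _ => ?_
      have hn' := Finset.mem_range.1 hn
      have := hshift' a b 0 n (N - 1 - n)
      rw [Nat.zero_add, show n + (N - 1 - n) = N - 1 by lia] at this
      rw [this]
    rw [h1, Finset.sum_range_reflect (fun k => ∑ a, ‖⟪f (b, N - 1), e (a, k)⟫_ℂ‖ ^ 2) N,
      Finset.sum_comm, ← Finset.sum_product']
    refine le_trans (le_of_eq (Finset.sum_congr rfl fun i _ => ?_))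
      ((he.sum_inner_products_le (f (b, N - 1)) (s := Finset.univ ×ˢ Finset.range N)).trans
        (by rw [hf, one_pow]))
    rw [norm_inner_symm]
  -- The total of all squared coefficients is the cardinality of `A`; summed by rows it is at most
  -- `1` for each element of `B`.
  have h1 := hasSum_sum (s := Finset.univ) fun a (_ : a ∈ Finset.univ) => hsum a
  have h2 : ∑ a : A, (1 : ℝ) ≤ Fintype.card B := by
    refine hasSum_le_of_sum_le h1 fun s => ?_
    obtain ⟨N, hN⟩ : ∃ N, s ⊆ Finset.univ ×ˢ Finset.range N := by
      refine ⟨s.sup Prod.snd + 1, fun j hj => ?_⟩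
      simp only [Finset.mem_product, Finset.mem_univ, Finset.mem_range, true_and]
      exact Nat.lt_succ_of_le (Finset.le_sup (f := Prod.snd) hj)
    refine (Finset.sum_le_sum_of_subset_of_nonneg hN fun j _ _ =>
      Finset.sum_nonneg fun a _ => by positivity).trans ?_
    rw [Finset.sum_product]
    refine (Finset.sum_le_sum fun b _ => hbound N b).trans ?_
    simp
  simpa using h2

theorem hasSum_sq_norm_inner {ι : Type*} (a : EllTwo ι) :
    HasSum (fun i => ‖⟪stdBasis ι i, a⟫_ℂ‖ ^ 2) (‖a‖ ^ 2) := by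
  have h := (stdBasis ι).hasSum_inner_mul_inner a a
  have h2 := Complex.reCLM.hasSum h
  convert h2 using 1
  · funext i
    rw [← inner_conj_symm, Complex.mul_conj, Complex.normSq_eq_norm_sq,
      RCLike.norm_conj]
    rfl
  · rw [inner_self_eq_norm_sq_to_K]
    norm_cast

/-! ### Winding around a cycle at a terminal vertex. -/

section Terminal

variable {V : Type u} [Quiver.{v} V]

/-- The powers of a closed path. -/
def pathPow {x : V} (c : Path x x) : ℕ → Path x x
  | 0 => .nil
  | n + 1 => c.comp (pathPow c n)

theorem length_pathPow {x : V} (c : Path x x) (n : ℕ) : (pathPow c n).length = n * c.length := by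
  induction n with
  | zero => simp [pathPow]
  | succ n ih => rw [pathPow, Path.length_comp, ih, Nat.succ_mul, Nat.add_comm]

/-- Paths that are initial segments of the same path and have equal length are equal. -/
theorem sigma_eq_of_comp_eq_comp {x a b y : V} {p : Path x a} {q : Path x b} {r : Path a y}
    {s : Path b y} (h : p.comp r = q.comp s) (hl : p.length = q.length) :
    (⟨a, p⟩ : Σ z, Path x z) = ⟨b, q⟩ := by
  obtain ⟨t, rfl⟩ := exists_eq_comp_of_comp_eq_comp h hl.le
  have ht : t.length = 0 := by simpa using hl
  obtain rfl := Path.eq_of_length_zero t ht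
  rw [Path.eq_nil_of_length_zero t ht, Path.comp_nil]

/-- The paths shorter than a cycle `c` from a vertex `x` to a set `X`. -/
abbrev ShortPaths (X : Set V) {x : V} (c : Path x x) : Type max u v :=
  {v : Σ b, Path x b // v.1 ∈ X ∧ v.2.length < c.length}

/-- The path "first `n` times `c`, then `v`". -/
def windAround {X : Set V} {x : V} (c : Path x x) (j : ShortPaths X c × ℕ) : FreeSemigroupoid V :=
  ⟨x, j.1.1.1, (pathPow c j.2).comp j.1.1.2⟩

/-- The number of windings is the quotient of the length by that of `c`, since the remaining path is
shorter than `c`; then the power of `c` cancels. -/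
theorem windAround_injective {X : Set V} {x : V} (c : Path x x) :
    Function.Injective (windAround (X := X) c) := by
  rintro ⟨⟨⟨a, p⟩, ha, hp⟩, m⟩ ⟨⟨⟨b, q⟩, hb, hq⟩, n⟩ h
  simp only [windAround, Sigma.mk.injEq, heq_eq_eq, true_and] at h hp hq
  obtain ⟨rfl, h⟩ := h
  have h := eq_of_heq h
  have hlen := congrArg Path.length h
  simp only [Path.length_comp, length_pathPow] at hlen
  have hmn : m = n := by
    have h1 := congrArg (· / c.length) hlen
    have hc : 0 < c.length := by lia
    simpa [Nat.mul_comm _ c.length, Nat.mul_add_div hc, Nat.div_eq_of_lt hp,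
      Nat.div_eq_of_lt hq] using h1
  subst hmn
  rw [Path.comp_inj_right] at h
  subst h
  rfl

variable {X : Set V} {x : V} {c : Path x x}

/-- A short path can be closed up, and a nonempty closed path begins with `c`. So a short path is an
initial segment of `c`, determined by its length. -/
theorem finite_shortPaths (hterm : ∀ y ∈ X, Nonempty (Path x y) → Nonempty (Path y x))
    (hc : ∀ w : Path x x, 0 < w.length → ∃ r, w = c.comp r) : Finite (ShortPaths X c) := by
  have hpre : ∀ v : ShortPaths X c, ∃ r : Path v.1.1 x, c = v.1.2.comp r := by
    rintro ⟨⟨a, p⟩, ha, hp⟩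
    obtain ⟨q⟩ := hterm a ha ⟨p⟩
    rcases Nat.eq_zero_or_pos (p.comp q).length with h | h
    · rw [Path.length_comp] at h
      have h0 : p.length = 0 := by lia
      obtain rfl := Path.eq_of_length_zero p h0
      exact ⟨c, by simp [Path.eq_nil_of_length_zero p h0]⟩
    · obtain ⟨r, hr⟩ := hc _ h
      exact exists_eq_comp_of_comp_eq_comp hr hp.le
  refine Finite.of_injective (fun v : ShortPaths X c => (⟨v.1.2.length, v.2.2⟩ : Fin c.length)) ?_
  intro v w h
  obtain ⟨r, hr⟩ := hpre v
  obtain ⟨s, hs⟩ := hpre w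
  exact Subtype.ext (sigma_eq_of_comp_eq_comp (hr.symm.trans hs) (Fin.mk.inj h))

/-- A path at least as long as `c` can be closed up, hence begins with `c`; remove `c` and induct on
the length. -/
theorem exists_windAround (hterm : ∀ y ∈ X, Nonempty (Path x y) → Nonempty (Path y x))
    (hpos : 0 < c.length) (hc : ∀ w : Path x x, 0 < w.length → ∃ r, w = c.comp r)
    {b : V} (hb : b ∈ X) (w : Path x b) : ∃ j, windAround (X := X) c j = ⟨x, b, w⟩ := by
  induction hn : w.length using Nat.strong_induction_on generalizing w with
  | _ n ih =>
    by_cases hlt : w.length < c.length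
    · exact ⟨(⟨⟨b, w⟩, hb, hlt⟩, 0), by simp [windAround, pathPow]⟩
    · obtain ⟨q⟩ := hterm b hb ⟨w⟩
      obtain ⟨r, hr⟩ := hc (w.comp q) (by simp; lia)
      obtain ⟨s, rfl⟩ := exists_eq_comp_of_comp_eq_comp hr.symm (by lia)
      rw [Path.length_comp] at hn
      obtain ⟨⟨v, m⟩, hj⟩ := ih s.length (by lia) s rfl
      refine ⟨(v, m + 1), ?_⟩
      simp only [windAround, Sigma.mk.injEq, heq_eq_eq, true_and] at hj ⊢
      obtain ⟨rfl, hj⟩ := hj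
      have hj := eq_of_heq hj
      simp [pathPow, ← hj]

/-- In a graph without double-cycles there are no two operators that commute with the right creation
operators and act as isometries with orthogonal ranges on the paths that end in a set `X` with a
terminal vertex. -/
theorem false_of_terminal (hdc : ¬ HasDoubleCycle V) {T : Bool → Fock V →L[ℂ] Fock V}
    (hcomm : ∀ i {a b : V} (p : Path a b), rightCreation p * T i = T i * rightCreation p)
    (hself : ∀ i (v w : FreeSemigroupoid V), w.2.1 ∈ X →
      ⟪T i (ξ v), T i (ξ w)⟫_ℂ = ⟪ξ v, ξ w⟫_ℂ)
    (hne : ∀ i j (v w : FreeSemigroupoid V), i ≠ j → ⟪T i (ξ v), T j (ξ w)⟫_ℂ = 0)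
    (hsupp : ∀ i (v w : FreeSemigroupoid V), ⟪ξ v, T i (ξ w)⟫_ℂ ≠ 0 → v.1 = w.1 ∧ v.2.1 ∈ X)
    (hx : x ∈ X) (hterm : ∀ y ∈ X, Nonempty (Path x y) → Nonempty (Path y x)) : False := by
  have hnorm : ∀ i (v : FreeSemigroupoid V), v.2.1 ∈ X → ‖T i (ξ v)‖ = 1 := by
    intro i v hv
    have h := hself i v v hv
    rw [show ⟪ξ v, ξ v⟫_ℂ = 1 from inner_stdBasis_self v, inner_self_eq_norm_sq_to_K] at h
    have h' : ‖T i (ξ v)‖ ^ 2 = 1 := Complex.ofReal_injective (by push_cast; exact h)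
    exact (pow_eq_one_iff_of_nonneg (norm_nonneg _) two_ne_zero).1 h'
  by_cases hloop : ∃ w : Path x x, 0 < w.length
  · obtain ⟨w, hw⟩ := hloop
    obtain ⟨c, hcyc, hc⟩ := exists_unique_first_cycle hdc w hw
    have hpos := hcyc.1
    have := finite_shortPaths hterm hc
    have := Fintype.ofFinite (ShortPaths X c)
    -- The two operators turn each generator of the shift by `c` into two, giving an orthonormal
    -- system with twice as many generators.
    let e : (ShortPaths X c × Bool) × ℕ → Fock V :=
      fun j => T j.1.2 (ξ (windAround c (j.1.1, j.2)))
    have he : Orthonormal ℂ e := by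
      refine ⟨fun j => hnorm _ _ j.1.1.2.1, ?_⟩
      rintro ⟨⟨v, i⟩, m⟩ ⟨⟨w, j⟩, n⟩ hvw
      by_cases hij : i = j
      · subst hij
        refine (hself i _ _ w.2.1).trans (inner_stdBasis_of_ne fun h => hvw ?_)
        have h' := windAround_injective c h
        simp only [Prod.mk.injEq] at h'
        rw [h'.1, h'.2]
      · exact hne i j _ _ hij
    -- By `hsupp` the vector is supported on paths from `x` to `X`, all of which wind around `c`; so
    -- this is Parseval's identity.
    have hsum : ∀ a, HasSum
        (fun j : ShortPaths X c × ℕ => ‖⟪ξ (windAround c j), e (a, 0)⟫_ℂ‖ ^ 2) 1 := by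
      rintro ⟨v, i⟩
      have h := hasSum_sq_norm_inner (e ((v, i), 0))
      rw [he.1, one_pow, ← (windAround_injective (X := X) c).hasSum_iff] at h
      · exact h
      · rintro ⟨a, b, w'⟩ hw
        by_contra h0
        have h1 : ⟪ξ ⟨a, b, w'⟩, T i (ξ (windAround c (v, 0)))⟫_ℂ ≠ 0 := fun h => h0 (by
          change ‖⟪ξ ⟨a, b, w'⟩, T i (ξ (windAround c (v, 0)))⟫_ℂ‖ ^ 2 = 0
          rw [h]; simp)
        obtain ⟨h2, h3⟩ := hsupp _ _ _ h1
        change a = x at h2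
        subst h2
        exact hw (exists_windAround hterm hpos hc h3 w')
    have hR : ∀ j : ShortPaths X c × ℕ, rightCreation c (ξ (windAround c j)) =
        ξ (windAround c (j.1, j.2 + 1)) := by
      intro j
      rw [windAround, rightCreation_apply, windAround, pathPow, Path.comp_assoc]
    have hshift : ∀ (a : ShortPaths X c × Bool) (b : ShortPaths X c) m n,
        ⟪ξ (windAround c (b, n + 1)), e (a, m + 1)⟫_ℂ =
          ⟪ξ (windAround c (b, n)), e (a, m)⟫_ℂ := by
      rintro ⟨v, i⟩ b m n
      simp only [e]
      rw [← hR (b, n), ← hR (v, m)]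
      have h1 := ContinuousLinearMap.ext_iff.1 (hcomm i c) (ξ (windAround c (v, m)))
      change rightCreation c (T i _) = T i (rightCreation c _) at h1
      rw [← h1, ← ContinuousLinearMap.adjoint_inner_left, ← ContinuousLinearMap.star_eq_adjoint]
      congr 1
      rw [hR, windAround, pathPow, Path.comp_assoc, star_rightCreation_apply]
      rfl
    have hcard := card_le_card_of_shift he (f := fun j => ξ (windAround c j))
      (fun j => (stdBasis (FreeSemigroupoid V)).orthonormal.1 _) hsum hshift
    have : Nonempty (ShortPaths X c) := ⟨⟨⟨x, .nil⟩, hx, hpos⟩⟩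
    have hcard0 : 0 < Fintype.card (ShortPaths X c) := Fintype.card_pos
    simp at hcard
    lia
  · push Not at hloop
    -- With no closed path of positive length at `x`, the only path from `x` to `X` is trivial. Both
    -- images of `ξ_x` are then unit multiples of `ξ_x` and cannot be orthogonal.
    have honly : ∀ i (v : FreeSemigroupoid V), v ≠ ⟨x, x, .nil⟩ →
        ⟪ξ v, T i (ξ ⟨x, x, .nil⟩)⟫_ℂ = 0 := by
      rintro i ⟨a, b, w⟩ hv
      by_contra h
      obtain ⟨h1, h2⟩ := hsupp _ _ _ h
      change a = x at h1
      subst h1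
      obtain ⟨q⟩ := hterm b h2 ⟨w⟩
      have h3 := hloop (w.comp q)
      rw [Path.length_comp] at h3
      have h4 : w.length = 0 := by lia
      obtain rfl := Path.eq_of_length_zero w h4
      rw [Path.eq_nil_of_length_zero w h4] at hv
      exact hv rfl
    have hmul : ∀ i, T i (ξ ⟨x, x, .nil⟩) =
        ⟪ξ ⟨x, x, .nil⟩, T i (ξ ⟨x, x, .nil⟩)⟫_ℂ • ξ ⟨x, x, .nil⟩ := by
      intro i
      refine ext_inner_stdBasis fun v => ?_
      rw [inner_smul_right]
      by_cases hv : v = ⟨x, x, .nil⟩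
      · rw [hv]
        erw [inner_stdBasis_self]
        rw [mul_one]
        rfl
      · erw [inner_stdBasis_of_ne hv]
        rw [mul_zero]
        exact honly i v hv
    have hT := fun i => hnorm i ⟨x, x, .nil⟩ hx
    have h0 := hne true false ⟨x, x, .nil⟩ ⟨x, x, .nil⟩ (by simp)
    have ht := hT true
    have hf := hT false
    rw [hmul] at ht hf
    rw [hmul true, hmul false, inner_smul_left, inner_smul_right] at h0
    erw [inner_stdBasis_self] at h0
    rw [mul_one, mul_eq_zero] at h0
    rcases h0 with h0 | h0
    · rw [map_eq_zero] at h0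
      rw [h0] at ht
      simp at ht
    · rw [h0] at hf
      simp at hf

end Terminal

/-- If the free semigroupoid algebra contains two nonzero partial isometries with the same initial
projection, which dominates their orthogonal final projections, then some infinite path is not
eventually periodic. -/
theorem exists_aperiodic_of_partialIsometries {V : Type u} [Quiver.{v} V] [Countable V]
    [∀ x y : V, Countable (x ⟶ y)] {U W : Fock V →L[ℂ] Fock V}
    (hU : U ∈ freeSemigroupoidAlgebra V) (hW : W ∈ freeSemigroupoidAlgebra V)
    (hUp : IsPartialIsometry U) (hU0 : U ≠ 0)
    (hUW : star U * U = star W * W) (hUle : U * star U ≤ star U * U)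
    (hWle : W * star W ≤ star W * W) (hort : star U * W = 0) :
    ∃ ω : InfinitePath V, ¬ ω.IsEventuallyPeriodic := by
  by_contra! hno
  have hdc : ¬ HasDoubleCycle V := fun h => by
    obtain ⟨ω, hω⟩ := h.exists_not_isEventuallyPeriodic
    exact hω (hno ω)
  obtain ⟨X, hX⟩ := hUp.exists_initial_vertices hU
  have hXne : X.Nonempty := by
    by_contra hemp
    rw [Set.not_nonempty_iff_eq_empty] at hemp
    refine hU0 ((CStarRing.star_mul_self_eq_zero_iff U).1 (clm_ext_stdBasis fun w => ?_))
    exact (hX w).2 (by simp [hemp])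
  obtain ⟨x, hx, hterm⟩ := exists_terminal hno hXne
  let T : Bool → Fock V →L[ℂ] Fock V := fun i => if i then U else W
  have hTmem : ∀ i, T i ∈ freeSemigroupoidAlgebra V := by
    rintro (_ | _)
    · exact hW
    · exact hU
  have hTP : ∀ i, star (T i) * T i = star U * U := by
    rintro (_ | _)
    · exact hUW.symm
    · rfl
  have hTle : ∀ i, T i * star (T i) ≤ star U * U := by
    rintro (_ | _)
    · exact hWle.trans hUW.symm.le
    · exact hUle
  have hinner : ∀ (A B : Fock V →L[ℂ] Fock V) a b, ⟪A a, B b⟫_ℂ = ⟪a, (star A * B) b⟫_ℂ := by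
    intro A B a b
    rw [ContinuousLinearMap.star_eq_adjoint, mul_apply_eq_comp,
      ContinuousLinearMap.adjoint_inner_right]
  refine false_of_terminal hdc (X := X) (T := T) (fun i a b p => rightCreation_mul_comm p (hTmem i))
    ?_ ?_ ?_ hx hterm
  · intro i v w hw
    rw [hinner, hTP, (hX w).1 hw]
  · have hort' : star W * U = 0 := by
      have := congrArg star hort
      rwa [star_mul, star_star, star_zero] at this
    rintro (_ | _) (_ | _) v w hij
    · exact absurd rfl hij
    · rw [hinner, show star (T false) * T true = 0 from hort']; simp
    · rw [hinner, show star (T true) * T false = 0 from hort]; simp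
    · exact absurd rfl hij
  · rintro i ⟨a, b, v⟩ ⟨a', b', w⟩ h
    constructor
    · by_contra haa
      refine h ?_
      -- The right creation operator of a vertex projects onto the paths starting there, so `T i`
      -- preserves initial vertices.
      have h1 : ξ ⟨a, b, v⟩ = rightCreation (.nil : Path a a) (ξ ⟨a, b, v⟩) := by
        rw [rightCreation_apply, Path.nil_comp]
      have h2 := star_rightCreation_mul_rightCreation (.nil : Path a a)
      have h3 : star (rightCreation (.nil : Path a a)) = rightCreation (.nil : Path a a) := by
        rw [← h2, star_mul, star_star]
      have h4 := ContinuousLinearMap.ext_iff.1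
        (rightCreation_mul_comm (.nil : Path a a) (hTmem i)) (ξ ⟨a', b', w⟩)
      change rightCreation _ (T i _) = T i (rightCreation _ _) at h4
      rw [h1, ← ContinuousLinearMap.adjoint_inner_right, ← ContinuousLinearMap.star_eq_adjoint,
        h3, h4, rightCreation_apply_of_ne _ _ (Ne.symm haa), map_zero, inner_zero_right]
    · by_contra hb
      refine h ?_
      -- The final projection lies below the initial one, which kills paths ending outside `X`.
      have h1 : star (T i) (ξ ⟨a, b, v⟩) = 0 := by
        have h2 := (ContinuousLinearMap.le_def _ _).1 (hTle i)
        have h3 := h2.re_inner_nonneg_right (ξ ⟨a, b, v⟩)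
        rw [sub_apply, (hX ⟨a, b, v⟩).2 hb, zero_sub, mul_apply_eq_comp, inner_neg_right,
          ContinuousLinearMap.star_eq_adjoint, ← ContinuousLinearMap.adjoint_inner_left,
          ← ContinuousLinearMap.star_eq_adjoint, map_neg, inner_self_eq_norm_sq] at h3
        have h4 : ‖star (T i) (ξ ⟨a, b, v⟩)‖ ^ 2 = 0 := le_antisymm (by linarith) (sq_nonneg _)
        exact norm_eq_zero.1 (pow_eq_zero_iff two_ne_zero |>.1 h4)
      rw [← ContinuousLinearMap.adjoint_inner_left, ← ContinuousLinearMap.star_eq_adjoint, h1,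
        inner_zero_left]

/-! ### Ampliations along families of basis isometries -/

section Ampliation

/-- The Hilbert sum of copies of an operator. -/
noncomputable def amplify (B : Type*) {H : Type*} [NormedAddCommGroup H] [InnerProductSpace ℂ H]
    (T : H →L[ℂ] H) : lp (fun _ : B => H) 2 →L[ℂ] lp (fun _ : B => H) 2 :=
  lp.mapCLM 2 (fun _ => T) (norm_nonneg T) fun _ => le_rfl

section

variable {B : Type*} {H : Type*} [NormedAddCommGroup H] [InnerProductSpace ℂ H]

@[simp] theorem amplify_apply (T : H →L[ℂ] H) (f : lp (fun _ : B => H) 2) (b : B) :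
    amplify B T f b = T (f b) := rfl

theorem amplify_mul (S T : H →L[ℂ] H) : amplify B (S * T) = amplify B S * amplify B T := by
  ext f b
  rfl

theorem adjoint_amplify [CompleteSpace H] (T : H →L[ℂ] H) :
    ContinuousLinearMap.adjoint (amplify B T) = amplify B (star T) := by
  symm
  rw [ContinuousLinearMap.eq_adjoint_iff]
  intro f g
  rw [lp.inner_eq_tsum, lp.inner_eq_tsum]
  refine tsum_congr fun b => ?_
  rw [amplify_apply, amplify_apply, ContinuousLinearMap.star_eq_adjoint,
    ContinuousLinearMap.adjoint_inner_left]

theorem amplify_single [DecidableEq B] (T : H →L[ℂ] H) (b : B) (a : H) :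
    amplify B T (lp.single 2 b a) = lp.single 2 b (T a) := by
  ext c
  rw [amplify_apply]
  by_cases h : c = b
  · subst h
    simp
  · simp [h]

theorem clm_ext_single [DecidableEq B] {E : Type*} [NormedAddCommGroup E] [NormedSpace ℂ E]
    {S T : lp (fun _ : B => H) 2 →L[ℂ] E}
    (h : ∀ b a, S (lp.single 2 b a) = T (lp.single 2 b a)) : S = T := by
  ext f
  have hf := lp.hasSum_single (E := fun _ : B => H) (p := 2) (by simp) f
  refine (hf.mapL S).unique ?_
  simp only [h]
  exact hf.mapL T

end

variable {B κ ι : Type*} (θ : B → (κ ↪ ι))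
  (hθ : ∀ b b' k k', θ b k = θ b' k' → b = b')

theorem adjoint_basisIsometry_comp_of_ne
    (hθ : ∀ b b' k k', θ b k = θ b' k' → b = b') {b b' : B} (h : b ≠ b') :
    ContinuousLinearMap.adjoint (basisIsometry (θ b)).toContinuousLinearMap ∘L
      (basisIsometry (θ b')).toContinuousLinearMap = 0 := by
  refine clm_ext_stdBasis fun k => ?_
  have h1 : (basisIsometry (θ b')).toContinuousLinearMap (stdBasis κ k) = stdBasis ι (θ b' k) :=
    basisIsometry_apply _ _
  rw [ContinuousLinearMap.comp_apply, h1, adjoint_basisIsometry_apply_of_notMem]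
  · rfl
  · rintro ⟨k', hk'⟩
    exact h (hθ _ _ _ _ hk')

theorem orthogonalFamily_basisIsometry (hθ : ∀ b b' k k', θ b k = θ b' k' → b = b') :
    OrthogonalFamily ℂ (fun _ : B => EllTwo κ) fun b => basisIsometry (θ b) := by
  intro b b' h a a'
  have h1 := ContinuousLinearMap.ext_iff.1 (adjoint_basisIsometry_comp_of_ne θ hθ h) a'
  have h2 := ContinuousLinearMap.adjoint_inner_right (basisIsometry (θ b)).toContinuousLinearMap a
    ((basisIsometry (θ b')).toContinuousLinearMap a')
  refine h2.symm.trans ?_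
  refine (congrArg _ h1).trans (inner_zero_right _)

/-- The isometry of a Hilbert sum of copies of `ℓ²(κ)` into `ℓ²(ι)` given by basis isometries with
disjoint ranges. -/
noncomputable def stack : lp (fun _ : B => EllTwo κ) 2 →L[ℂ] EllTwo ι :=
  (orthogonalFamily_basisIsometry θ hθ).linearIsometry.toContinuousLinearMap

theorem stack_single [DecidableEq B] (b : B) (a : EllTwo κ) :
    stack θ hθ (lp.single 2 b a) = basisIsometry (θ b) a :=
  (orthogonalFamily_basisIsometry θ hθ).linearIsometry_apply_single a

theorem adjoint_stack_comp :
    ContinuousLinearMap.adjoint (stack θ hθ) ∘L stack θ hθ = 1 :=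
  (ContinuousLinearMap.norm_map_iff_adjoint_comp_self _).1
    (orthogonalFamily_basisIsometry θ hθ).linearIsometry.norm_map

theorem adjoint_stack_apply (f : lp (fun _ : B => EllTwo κ) 2) :
    ContinuousLinearMap.adjoint (stack θ hθ) (stack θ hθ f) = f :=
  ContinuousLinearMap.ext_iff.1 (adjoint_stack_comp θ hθ) f

theorem adjoint_stack_apply_of_notMem {i : ι} (hi : ∀ b k, θ b k ≠ i) :
    ContinuousLinearMap.adjoint (stack θ hθ) (stdBasis ι i) = 0 := by
  classical
  refine ext_inner_right ℂ fun f => ?_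
  rw [ContinuousLinearMap.adjoint_inner_left, inner_zero_left]
  have h : (innerSL ℂ (stdBasis ι i)) ∘L stack θ hθ = 0 := by
    refine clm_ext_single fun b a => ?_
    rw [ContinuousLinearMap.comp_apply, stack_single, zero_apply, innerSL_apply_apply]
    have h2 := ContinuousLinearMap.adjoint_inner_left
      (basisIsometry (θ b)).toContinuousLinearMap a (stdBasis ι i)
    rw [adjoint_basisIsometry_apply_of_notMem _ (by rintro ⟨k, hk⟩; exact hi b k hk),
      inner_zero_left] at h2
    exact h2.symm
  exact ContinuousLinearMap.ext_iff.1 h f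

/-- The `*`-homomorphism `T ↦ ⨁ T` of the operators on `ℓ²(κ)` into the operators on `ℓ²(ι)` given
by basis isometries with disjoint ranges. -/
noncomputable def ampliation :
    (EllTwo κ →L[ℂ] EllTwo κ) →⋆ₙₐ[ℂ] (EllTwo ι →L[ℂ] EllTwo ι) where
  toFun T := stack θ hθ ∘L amplify B T ∘L ContinuousLinearMap.adjoint (stack θ hθ)
  map_smul' c T := by
    have : amplify B (c • T) = c • amplify B T := by ext f b; rfl
    rw [this]
    ext a : 1
    simp
  map_zero' := by
    have : amplify B (0 : EllTwo κ →L[ℂ] EllTwo κ) = 0 := by ext f b; rfl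
    rw [this]
    ext a : 1
    simp
  map_add' S T := by
    have : amplify B (S + T) = amplify B S + amplify B T := by ext f b; rfl
    rw [this]
    ext a : 1
    simp
  map_mul' S T := by
    rw [amplify_mul]
    ext a : 1
    simp [mul_apply_eq_comp, adjoint_stack_apply]
  map_star' T := by
    rw [ContinuousLinearMap.star_eq_adjoint, ContinuousLinearMap.star_eq_adjoint,
      ContinuousLinearMap.adjoint_comp, ContinuousLinearMap.adjoint_comp,
      ContinuousLinearMap.adjoint_adjoint, adjoint_amplify, ContinuousLinearMap.star_eq_adjoint]
    rfl

theorem ampliation_apply (T : EllTwo κ →L[ℂ] EllTwo κ) :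
    ampliation θ hθ T = stack θ hθ ∘L amplify B T ∘L ContinuousLinearMap.adjoint (stack θ hθ) :=
  rfl

theorem ampliation_basisIsometry (T : EllTwo κ →L[ℂ] EllTwo κ) (b : B) (a : EllTwo κ) :
    ampliation θ hθ T (basisIsometry (θ b) a) = basisIsometry (θ b) (T a) := by
  classical
  rw [ampliation_apply, ContinuousLinearMap.comp_apply, ContinuousLinearMap.comp_apply,
    ← stack_single θ hθ, adjoint_stack_apply, amplify_single, stack_single]

theorem ampliation_stdBasis (T : EllTwo κ →L[ℂ] EllTwo κ) (b : B) (k : κ) :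
    ampliation θ hθ T (stdBasis ι (θ b k)) = basisIsometry (θ b) (T (stdBasis κ k)) := by
  rw [← basisIsometry_apply, ampliation_basisIsometry]

theorem ampliation_apply_of_notMem (T : EllTwo κ →L[ℂ] EllTwo κ) {i : ι}
    (hi : ∀ b k, θ b k ≠ i) : ampliation θ hθ T (stdBasis ι i) = 0 := by
  rw [ampliation_apply, ContinuousLinearMap.comp_apply, ContinuousLinearMap.comp_apply,
    adjoint_stack_apply_of_notMem θ hθ hi, map_zero, map_zero]

/-- This is the adjoint of the intertwining relation for `star T`. -/
theorem adjoint_basisIsometry_ampliation (T : EllTwo κ →L[ℂ] EllTwo κ) (b : B) (a : EllTwo ι) :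
    ContinuousLinearMap.adjoint (basisIsometry (θ b)).toContinuousLinearMap
      (ampliation θ hθ T a) =
    T (ContinuousLinearMap.adjoint (basisIsometry (θ b)).toContinuousLinearMap a) := by
  refine ext_inner_left ℂ fun c => ?_
  rw [ContinuousLinearMap.adjoint_inner_right, ← ContinuousLinearMap.adjoint_inner_left T,
    ContinuousLinearMap.adjoint_inner_right, ← ContinuousLinearMap.star_eq_adjoint,
    ← ContinuousLinearMap.adjoint_inner_left, ← ContinuousLinearMap.star_eq_adjoint, ← map_star]
  exact congrArg (fun x => ⟪x, a⟫_ℂ) (ampliation_basisIsometry θ hθ (star T) b c)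

theorem ampliation_injective [Nonempty B] : Function.Injective (ampliation θ hθ) := by
  rw [injective_iff_map_eq_zero]
  intro T hT
  obtain ⟨b⟩ := ‹Nonempty B›
  ext1 a
  have h := ampliation_basisIsometry θ hθ T b a
  rw [hT, zero_apply] at h
  exact (map_eq_zero_iff _ (basisIsometry (θ b)).injective).1 h.symm

/-- On operators that commute with a family of basis isometries with disjoint ranges, the
ampliation is a compression. -/
theorem ampliation_eq_of_commute (ρ : B → (κ ↪ κ)) (hρ : ∀ b b' k k', ρ b k = ρ b' k' → b = b')
    {A : EllTwo κ →L[ℂ] EllTwo κ}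
    (hA : ∀ b a, A (basisIsometry (ρ b) a) = basisIsometry (ρ b) (A a)) :
    ampliation θ hθ A = (stack θ hθ ∘L ContinuousLinearMap.adjoint (stack ρ hρ)) ∘L A ∘L
      (stack ρ hρ ∘L ContinuousLinearMap.adjoint (stack θ hθ)) := by
  classical
  -- The range of each `ρ b` is invariant under `A` and carries a copy of `A`, so `A` itself
  -- compresses to the Hilbert sum of copies of `A`. The outer factors do not depend on `A`, which
  -- makes the formula WOT continuous in `A`.
  have h : A ∘L stack ρ hρ = stack ρ hρ ∘L amplify B A := by
    refine clm_ext_single fun b a => ?_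
    rw [ContinuousLinearMap.comp_apply, ContinuousLinearMap.comp_apply, amplify_single,
      stack_single, stack_single, hA]
  have h2 : ContinuousLinearMap.adjoint (stack ρ hρ) ∘L A ∘L stack ρ hρ = amplify B A := by
    rw [h, ← ContinuousLinearMap.comp_assoc, adjoint_stack_comp]
    rfl
  rw [ampliation_apply, ← h2]
  rfl

/-- Ampliations map the double commutant of a set of operators into the double commutant of
every set that contains the ampliation of the set and of the identity. -/
theorem ampliation_mem_generatedVonNeumannAlgebra {S : Set (EllTwo κ →L[ℂ] EllTwo κ)}
    {S' : Set (EllTwo ι →L[ℂ] EllTwo ι)} (hS : ∀ A ∈ S, ampliation θ hθ A ∈ S')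
    (h1 : ampliation θ hθ 1 ∈ S') {T : EllTwo κ →L[ℂ] EllTwo κ}
    (hT : T ∈ (generatedVonNeumannAlgebra S).toStarSubalgebra) :
    ampliation θ hθ T ∈ (generatedVonNeumannAlgebra S').toStarSubalgebra := by
  have hT' : ∀ Y : EllTwo κ →L[ℂ] EllTwo κ, (∀ A ∈ S, A * Y = Y * A ∧ star A * Y = Y * star A) →
      Y * T = T * Y := fun Y hY =>
    ((StarSubalgebra.mem_centralizer_iff ℂ).1 hT Y ((StarSubalgebra.mem_centralizer_iff ℂ).2 hY)).1
  have key : ∀ X : EllTwo ι →L[ℂ] EllTwo ι,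
      (∀ A ∈ S', A * X = X * A ∧ star A * X = X * star A) →
      X * ampliation θ hθ T = ampliation θ hθ T * X := by
    intro X hX
    have hE := (hX _ h1).1
    -- The matrix blocks of `X` commute with `S` and its adjoints, hence with `T`.
    have hcomp : ∀ b b', T * (ContinuousLinearMap.adjoint (basisIsometry (θ b)).toContinuousLinearMap
        ∘L X ∘L (basisIsometry (θ b')).toContinuousLinearMap) =
        (ContinuousLinearMap.adjoint (basisIsometry (θ b)).toContinuousLinearMap
        ∘L X ∘L (basisIsometry (θ b')).toContinuousLinearMap) * T := by
      intro b b'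
      refine (hT' _ fun A hA => ?_).symm
      have haux : ∀ A, ampliation θ hθ A * X = X * ampliation θ hθ A →
          A * (ContinuousLinearMap.adjoint (basisIsometry (θ b)).toContinuousLinearMap
          ∘L X ∘L (basisIsometry (θ b')).toContinuousLinearMap) =
          (ContinuousLinearMap.adjoint (basisIsometry (θ b)).toContinuousLinearMap
          ∘L X ∘L (basisIsometry (θ b')).toContinuousLinearMap) * A := by
        intro A hAX
        ext1 a
        have h2 := ContinuousLinearMap.ext_iff.1 hAX (basisIsometry (θ b') a)
        simp only [mul_apply_eq_comp] at h2
        rw [ampliation_basisIsometry] at h2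
        simp only [mul_apply_eq_comp, ContinuousLinearMap.comp_apply,
          LinearIsometry.coe_toContinuousLinearMap]
        rw [← adjoint_basisIsometry_ampliation θ hθ, h2]
      refine ⟨haux A (hX _ (hS A hA)).1, haux (star A) ?_⟩
      rw [map_star]
      exact (hX _ (hS A hA)).2
    set Φ := ampliation θ hθ with hΦ
    have hr : Φ T * Φ 1 = Φ T := by rw [← map_mul, mul_one]
    have hl : Φ 1 * Φ T = Φ T := by rw [← map_mul, one_mul]
    refine clm_ext_stdBasis fun j => ?_
    by_cases hj : ∃ b k, θ b k = j
    · obtain ⟨b', k', rfl⟩ := hj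
      refine ext_inner_stdBasis fun i => ?_
      by_cases hi : ∃ b k, θ b k = i
      · obtain ⟨b, k, rfl⟩ := hi
        have h2 := ContinuousLinearMap.ext_iff.1 (hcomp b b') (stdBasis κ k')
        simp only [mul_apply_eq_comp, ContinuousLinearMap.comp_apply,
          LinearIsometry.coe_toContinuousLinearMap] at h2
        rw [← adjoint_basisIsometry_ampliation θ hθ, ← ampliation_basisIsometry θ hθ,
          basisIsometry_apply] at h2
        have h3 := congrArg (fun a => ⟪stdBasis κ k, a⟫_ℂ) h2
        simp only [ContinuousLinearMap.adjoint_inner_right] at h3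
        have h4 : (basisIsometry (θ b)).toContinuousLinearMap (stdBasis κ k) =
          stdBasis ι (θ b k) := basisIsometry_apply _ _
        rw [h4] at h3
        exact h3.symm
      · push Not at hi
        have hzero : ∀ A a, ⟪stdBasis ι i, Φ A a⟫_ℂ = 0 := by
          intro A a
          rw [← ContinuousLinearMap.adjoint_inner_left, ← ContinuousLinearMap.star_eq_adjoint,
            ← map_star, hΦ, ampliation_apply_of_notMem θ hθ _ hi, inner_zero_left]
        -- Outside the copies there are no blocks to compare; there `X` is controlled because it
        -- commutes with the projection `Φ 1`.
        have h3 : X * Φ T = Φ 1 * (X * Φ T) := by rw [← mul_assoc, hE, mul_assoc, hl]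
        rw [h3]
        simp only [mul_apply_eq_comp, hzero]
    · push Not at hj
      have h3 : Φ T * X = Φ T * X * Φ 1 := by
        rw [mul_assoc, ← hE, ← mul_assoc, hr]
      rw [h3]
      simp only [mul_apply_eq_comp]
      rw [hΦ, ampliation_apply_of_notMem θ hθ _ hj, ampliation_apply_of_notMem θ hθ _ hj]
      simp
  refine (StarSubalgebra.mem_centralizer_iff ℂ).2 fun X hX => ?_
  refine ⟨key X ((StarSubalgebra.mem_centralizer_iff ℂ).1 hX), key (star X) ?_⟩
  exact (StarSubalgebra.mem_centralizer_iff ℂ).1 (star_mem hX)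

end Ampliation

/-! ### The graph with two loops -/

section TwoLoops

/-- The action of the words in two letters that is generated by two maps. -/
def wordAction {Ω : Type*} (m : Fin 2 → Ω → Ω) {a : TwoLoops} :
    ∀ {b : TwoLoops}, Path a b → Ω → Ω
  | _, .nil, ω => ω
  | _, .cons w e, ω => m e (wordAction m w ω)

variable {Ω : Type*} {m : Fin 2 → Ω → Ω}

/-- Peel off last letters with `hm`; neither word can outlast the other, because `ω` and `ω'` are
not in the image of any `m i`. -/
theorem wordAction_inj (hm : ∀ i j ω ω', m i ω = m j ω' → i = j ∧ ω = ω') {ω ω' : Ω}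
    (hω : ∀ i a, m i a ≠ ω) (hω' : ∀ i a, m i a ≠ ω') {a b : TwoLoops} (w : Path a b)
    {a' b' : TwoLoops} (w' : Path a' b') (h : wordAction m w ω = wordAction m w' ω') :
    ω = ω' ∧ (⟨a, b, w⟩ : FreeSemigroupoid TwoLoops) = ⟨a', b', w'⟩ := by
  induction w generalizing b' with
  | nil =>
    cases w' with
    | nil => exact ⟨h, rfl⟩
    | cons w' e => exact absurd h.symm (hω _ _)
  | cons w e ih =>
    cases w' with
    | nil => exact absurd h (hω' _ _)
    | cons w' e' =>
      obtain ⟨h1, h2⟩ := hm _ _ _ _ h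
      obtain ⟨h3, h4⟩ := ih w' h2
      refine ⟨h3, ?_⟩
      simp only [Sigma.mk.injEq] at h4
      obtain ⟨rfl, h4⟩ := h4
      simp only [heq_eq_eq, Sigma.mk.injEq] at h4
      obtain ⟨rfl, h4⟩ := h4
      obtain rfl := h4
      obtain rfl : e = e' := h1
      rfl

/-- Undoing a letter lowers `s`, so the descent ends at a point in no image. Together with
`wordAction_inj`, the orbits of such points partition `Ω` into free copies of the words. -/
theorem exists_wordAction_eq {s : Ω → ℕ} (hs : ∀ i ω, s ω < s (m i ω)) (ω : Ω) :
    ∃ (b : {ω : Ω // ∀ i a, m i a ≠ ω}) (w : FreeSemigroupoid TwoLoops),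
      wordAction m w.2.2 b.1 = ω := by
  induction hn : s ω using Nat.strong_induction_on generalizing ω with
  | _ n ih =>
    by_cases h : ∀ i a, m i a ≠ ω
    · exact ⟨⟨ω, h⟩, ⟨SingleObj.star _, SingleObj.star _, .nil⟩, rfl⟩
    · push Not at h
      obtain ⟨i, a, rfl⟩ := h
      obtain ⟨b, ⟨x, y, w⟩, hw⟩ := ih (s a) (by have := hs i a; lia) a rfl
      exact ⟨b, ⟨x, SingleObj.star _, w.cons (SingleObj.toHom i)⟩, congrArg (m i) hw⟩

/-- The word "`n` times the first loop, then the second loop". -/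
def prefixWord (n : ℕ) : Path (SingleObj.star (Fin 2)) (SingleObj.star (Fin 2)) :=
  ((fun p => Path.cons p (SingleObj.toHom (0 : Fin 2)))^[n] .nil).cons (SingleObj.toHom (1 : Fin 2))

theorem arrows_prefixWord (n : ℕ) : arrows (prefixWord n) =
    List.replicate n ⟨_, _, SingleObj.toHom (0 : Fin 2)⟩ ++ [⟨_, _, SingleObj.toHom (1 : Fin 2)⟩] := by
  rw [prefixWord, arrows_cons]
  congr 1
  induction n with
  | zero => rfl
  | succ n ih => rw [Function.iterate_succ_apply', arrows_cons, ih, List.replicate_succ']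

theorem replicate_append_cons_inj {α : Type*} {s t : α} (hst : s ≠ t) :
    ∀ (m n : ℕ) (l l' : List α), List.replicate m s ++ t :: l = List.replicate n s ++ t :: l' → m = n
  | 0, 0, _, _, _ => rfl
  | 0, n + 1, _, _, h => by
    simp only [List.replicate_succ, List.replicate_zero, List.nil_append, List.cons_append,
      List.cons.injEq] at h
    exact absurd h.1.symm hst
  | m + 1, 0, _, _, h => by
    simp only [List.replicate_succ, List.replicate_zero, List.nil_append, List.cons_append,
      List.cons.injEq] at h
    exact absurd h.1 hst
  | m + 1, n + 1, l, l', h => by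
    simp only [List.replicate_succ, List.cons_append, List.cons.injEq, true_and] at h
    rw [replicate_append_cons_inj hst m n l l' h]

/-- The map `w ↦ wp` on the words `w`, for `p` a prefix word. -/
def precedeByPrefix (n : ℕ) : FreeSemigroupoid TwoLoops ↪ FreeSemigroupoid TwoLoops where
  toFun w := ⟨SingleObj.star _, w.2.1, (prefixWord n).comp (b := SingleObj.star (Fin 2)) w.2.2⟩
  inj' := by
    rintro ⟨a, b, w⟩ ⟨a', b', w'⟩ h
    obtain rfl : a = SingleObj.star (Fin 2) := rfl
    obtain rfl : a' = SingleObj.star (Fin 2) := rfl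
    obtain rfl : b = SingleObj.star (Fin 2) := rfl
    obtain rfl : b' = SingleObj.star (Fin 2) := rfl
    simpa using h

/-- The number of first loops before the first occurrence of the second loop recovers `n`. An
infinite family of such words is used because there may be infinitely many orbits. -/
theorem precedeByPrefix_disjoint {m n : ℕ} {w w' : FreeSemigroupoid TwoLoops}
    (h : precedeByPrefix m w = precedeByPrefix n w') : m = n := by
  obtain ⟨a, b, w⟩ := w
  obtain ⟨a', b', w'⟩ := w'
  obtain rfl : a = SingleObj.star (Fin 2) := rfl
  obtain rfl : a' = SingleObj.star (Fin 2) := rfl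
  obtain rfl : b = SingleObj.star (Fin 2) := rfl
  obtain rfl : b' = SingleObj.star (Fin 2) := rfl
  change (⟨_, _, (prefixWord m).comp w⟩ : FreeSemigroupoid TwoLoops) =
    ⟨_, _, (prefixWord n).comp w'⟩ at h
  simp only [Sigma.mk.injEq, heq_eq_eq, true_and] at h
  have h1 := congrArg arrows h
  simp only [arrows_comp, arrows_prefixWord, List.append_assoc, List.cons_append,
    List.nil_append] at h1
  refine replicate_append_cons_inj ?_ m n _ _ h1
  intro h2
  simp only [Total.mk.injEq, heq_eq_eq, true_and] at h2
  exact absurd (SingleObj.toHom.injective h2) (by decide)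

theorem basisIsometry_precedeByPrefix (n : ℕ) :
    (basisIsometry (precedeByPrefix n)).toContinuousLinearMap = rightCreation (prefixWord n) := by
  refine clm_ext_stdBasis ?_
  rintro ⟨a, b, w⟩
  obtain rfl : a = SingleObj.star (Fin 2) := rfl
  refine (basisIsometry_apply _ _).trans ?_
  exact (rightCreation_apply (prefixWord n) w).symm

theorem creation_nil_twoLoops (x : TwoLoops) : creation (Path.nil : Path x x) = 1 := by
  refine clm_ext_stdBasis ?_
  rintro ⟨a, b, w⟩
  obtain rfl : b = x := rfl
  exact creation_apply _ w

end TwoLoops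

/-! ### Partly free algebras -/

section PartlyFree

variable {V : Type u} [Quiver.{v} V]

theorem countable_freeSemigroupoid [Countable V] [∀ x y : V, Countable (x ⟶ y)] :
    Countable (FreeSemigroupoid V) := by
  have := countable_total (V := V)
  have : ∀ x y : V, Countable (Path x y) := fun x y =>
    Function.Injective.countable (f := fun p : Path x y => arrows p) fun p q h => by
      have h0 : arrows p <+: arrows q := ⟨[], by simpa using h⟩
      obtain ⟨r, hr⟩ := exists_eq_comp_of_arrows_prefix p q h0
      have h1 := congrArg List.length h
      simp only [length_arrows] at h1
      have h2 := congrArg Path.length hr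
      rw [Path.length_comp] at h2
      rw [hr, Path.eq_nil_of_length_zero r (by lia), Path.comp_nil]
  infer_instance

/-- If two families of paths, one path of each family for each vertex of a set, generate a free
action on the paths with final vertex in the set, then the algebra is partly free. -/
theorem isPartlyFree_of_paths [Countable V] [∀ x y : V, Countable (x ⟶ y)] {κ : Type*} [Nonempty κ]
    {x : κ → V} (hx : Function.Injective x) {t : Fin 2 → κ → κ}
    (p : ∀ i k, Path (x k) (x (t i k))) (hpos : ∀ i k, 0 < (p i k).length)
    (hinj : ∀ i j k l (z : V) (w : Path z (x k)) (w' : Path z (x l)),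
      (⟨z, x (t i k), w.comp (p i k)⟩ : FreeSemigroupoid V) =
        ⟨z, x (t j l), w'.comp (p j l)⟩ → i = j ∧ k = l) :
    IsPartlyFree (freeSemigroupoidAlgebra V) := by
  have := countable_freeSemigroupoid (V := V)
  let inc : (Σ k, Σ z, Path z (x k)) ↪ FreeSemigroupoid V :=
    ⟨fun ω => ⟨ω.2.1, x ω.1, ω.2.2⟩, by
      rintro ⟨k, z, w⟩ ⟨k', z', w'⟩ h
      simp only [Sigma.mk.injEq] at h
      obtain ⟨rfl, h⟩ := h
      simp only [heq_eq_eq, Sigma.mk.injEq] at h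
      obtain ⟨h1, h⟩ := h
      obtain rfl := hx h1
      rw [eq_of_heq h]⟩
  let m : Fin 2 → (Σ k, Σ z, Path z (x k)) → (Σ k, Σ z, Path z (x k)) :=
    fun i ω => ⟨t i ω.1, ω.2.1, ω.2.2.comp (p i ω.1)⟩
  have hm : ∀ i j ω ω', m i ω = m j ω' → i = j ∧ ω = ω' := by
    rintro i j ⟨k, z, w⟩ ⟨k', z', w'⟩ h
    have h' := congrArg inc h
    change (⟨z, x (t i k), w.comp (p i k)⟩ : FreeSemigroupoid V) =
        ⟨z', x (t j k'), w'.comp (p j k')⟩ at h'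
    obtain rfl := congrArg Sigma.fst h'
    obtain ⟨rfl, rfl⟩ := hinj _ _ _ _ _ _ _ h'
    simp only [Sigma.mk.injEq, heq_eq_eq, true_and, Path.comp_inj_left] at h'
    exact ⟨rfl, by rw [h']⟩
  have hs : ∀ i ω, (fun ω : Σ k, Σ z, Path z (x k) => ω.2.2.length) ω <
      (fun ω : Σ k, Σ z, Path z (x k) => ω.2.2.length) (m i ω) := by
    rintro i ⟨k, z, w⟩
    have := hpos i k
    simp only [m, Path.length_comp]
    lia
  -- The generating paths: those that do not arise by applying a letter. Each contributes one copy
  -- of the Fock space of `TwoLoops`.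
  let B := {ω : Σ k, Σ z, Path z (x k) // ∀ i a, m i a ≠ ω}
  let θ : B → (FreeSemigroupoid TwoLoops ↪ FreeSemigroupoid V) := fun b =>
    ⟨fun w => inc (wordAction m w.2.2 b.1), fun w w' h =>
      (wordAction_inj hm b.2 b.2 w.2.2 w'.2.2 (inc.injective h)).2⟩
  have hθ : ∀ b b' k k', θ b k = θ b' k' → b = b' := fun b b' k k' h =>
    Subtype.ext (wordAction_inj hm b.2 b'.2 k.2.2 k'.2.2 (inc.injective h)).1
  have hrange : ∀ i, (∃ b k, θ b k = i) ↔ i ∈ Set.range inc := by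
    intro i
    constructor
    · rintro ⟨b, k, rfl⟩
      exact ⟨_, rfl⟩
    · rintro ⟨ω, rfl⟩
      obtain ⟨b, w, h⟩ := exists_wordAction_eq hs ω
      exact ⟨b, w, congrArg inc h⟩
  have hB : Nonempty B := by
    obtain ⟨k⟩ := ‹Nonempty κ›
    obtain ⟨b, -⟩ := exists_wordAction_eq hs ⟨k, x k, .nil⟩
    exact ⟨b⟩
  have hBc : Countable B := (inc.injective.comp Subtype.val_injective).countable
  obtain ⟨g, hg⟩ := exists_injective_nat B
  let ρ : B → (FreeSemigroupoid TwoLoops ↪ FreeSemigroupoid TwoLoops) := fun b =>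
    precedeByPrefix (g b)
  have hρ : ∀ b b' k k', ρ b k = ρ b' k' → b = b' := fun b b' k k' h =>
    hg (precedeByPrefix_disjoint h)
  set A := freeSemigroupoidAlgebra V with hA
  -- The orbits exhaust the paths ending in some `x k`, so the image of `1` is the strong sum of the
  -- vertex projections at the `x k`.
  have hone : ampliation θ hθ 1 ∈ A := by
    have h : ampliation θ hθ 1 = partialMap inc inc := by
      refine clm_ext_stdBasis fun i => ?_
      by_cases hi : i ∈ Set.range inc
      · obtain ⟨ω, rfl⟩ := hi
        rw [partialMap_apply]
        obtain ⟨b, k, hbk⟩ := (hrange _).2 ⟨ω, rfl⟩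
        rw [← hbk, ampliation_stdBasis, one_apply_eq_self, basisIsometry_apply]
      · rw [partialMap_apply_of_notMem _ _ hi, ampliation_apply_of_notMem]
        intro b k h
        exact hi ((hrange _).1 ⟨b, k, h⟩)
    rw [h]
    exact partialMap_mem_of_isWOTClosed inc inc (isWOTClosed_wotAlg _) fun k =>
      creation_nil_mem (x k)
  -- The image of the creation operator of loop `i` is the strong sum over `k` of the creation
  -- operators of `p i k`.
  have hgen : ∀ (a b : TwoLoops) (e : a ⟶ b), ampliation θ hθ (creation e.toPath) ∈ A := by
    intro a b e
    let i : Fin 2 := e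
    let minc : (Σ k, Σ z, Path z (x k)) ↪ FreeSemigroupoid V :=
      ⟨fun ω => inc (m i ω), fun ω ω' h => (hm _ _ _ _ (inc.injective h)).2⟩
    have h : ampliation θ hθ (creation e.toPath) = partialMap inc minc := by
      refine clm_ext_stdBasis fun j => ?_
      by_cases hj : j ∈ Set.range inc
      · obtain ⟨ω, rfl⟩ := hj
        rw [partialMap_apply]
        obtain ⟨c, w, rfl⟩ := exists_wordAction_eq hs ω
        change ampliation θ hθ (creation e.toPath) (stdBasis _ (θ c w)) = _
        rw [ampliation_stdBasis]
        obtain ⟨a', b', w⟩ := w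
        obtain rfl : b' = a := rfl
        have h2 : creation e.toPath (stdBasis _ ⟨a', b', w⟩) = stdBasis _ ⟨a', b, w.cons e⟩ :=
          creation_apply _ w
        rw [h2, basisIsometry_apply]
        rfl
      · rw [partialMap_apply_of_notMem _ _ hj, ampliation_apply_of_notMem]
        intro c k h
        exact hj ((hrange _).1 ⟨c, k, h⟩)
    rw [h]
    exact partialMap_mem_of_isWOTClosed inc minc (isWOTClosed_wotAlg _) fun k =>
      creation_mem (p i k)
  let R : Set (Fock TwoLoops →L[ℂ] Fock TwoLoops) :=
    Set.range fun n => rightCreation (prefixWord n)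
  have hcomm : ∀ {T : Fock TwoLoops →L[ℂ] Fock TwoLoops},
      T ∈ NonUnitalSubalgebra.centralizer ℂ R → ∀ b a,
      T (basisIsometry (ρ b) a) = basisIsometry (ρ b) (T a) := by
    intro T hT b a
    have h : rightCreation (prefixWord (g b)) * T = T * rightCreation (prefixWord (g b)) :=
      (NonUnitalSubalgebra.mem_centralizer_iff ℂ).1 hT _ ⟨g b, rfl⟩
    rw [← basisIsometry_precedeByPrefix] at h
    exact (ContinuousLinearMap.ext_iff.1 h a).symm
  -- Intersecting with the commutant of `R` makes the preimage of `A` WOT-closed, since the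
  -- ampliation is a compression there.
  let C : NonUnitalSubalgebra ℂ (Fock TwoLoops →L[ℂ] Fock TwoLoops) :=
    NonUnitalSubalgebra.centralizer ℂ R ⊓
      A.comap (ampliation θ hθ : (Fock TwoLoops →L[ℂ] Fock TwoLoops) →ₙₐ[ℂ] (Fock V →L[ℂ] Fock V))
  have hC : IsWOTClosed (C : Set (Fock TwoLoops →L[ℂ] Fock TwoLoops)) := by
    have h : {T : Fock TwoLoops →WOT[ℂ] Fock TwoLoops |
          T.toCLM ∈ (C : Set (Fock TwoLoops →L[ℂ] Fock TwoLoops))} =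
        {T | T.toCLM ∈ (NonUnitalSubalgebra.centralizer ℂ R :
          Set (Fock TwoLoops →L[ℂ] Fock TwoLoops))} ∩
        {T | (stack θ hθ ∘L ContinuousLinearMap.adjoint (stack ρ hρ)) ∘L T.toCLM ∘L
          (stack ρ hρ ∘L ContinuousLinearMap.adjoint (stack θ hθ)) ∈ A} := by
      ext T
      refine and_congr_right fun hT => ?_
      change ampliation θ hθ T.toCLM ∈ A ↔ _
      rw [ampliation_eq_of_commute θ hθ ρ hρ (hcomm hT)]
      rfl
    rw [IsWOTClosed, h]
    refine IsClosed.inter (isWOTClosed_centralizer R) ?_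
    exact IsClosed.preimage (continuous_wot_comp _ _)
      (isWOTClosed_wotAlg _ : IsWOTClosed (A : Set (Fock V →L[ℂ] Fock V)))
  have hle : freeSemigroupAlgebraTwo ≤ C := by
    refine wotAlg_le hC ?_
    intro T hT
    have hmemtwo : T ∈ freeSemigroupoidAlgebra TwoLoops := subset_wotAlg _ hT
    refine ⟨?_, ?_⟩
    · refine (NonUnitalSubalgebra.mem_centralizer_iff ℂ).2 ?_
      rintro _ ⟨n, rfl⟩
      exact rightCreation_mul_comm _ hmemtwo
    · change ampliation θ hθ T ∈ A
      rcases hT with ⟨a, rfl⟩ | ⟨a, b, e, rfl⟩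
      · rw [creation_nil_twoLoops]
        exact hone
      · exact hgen a b e
  have hmem : ∀ T : (generatedVonNeumannAlgebra
      (freeSemigroupAlgebraTwo : Set (Fock TwoLoops →L[ℂ] Fock TwoLoops))).toStarSubalgebra,
      ampliation θ hθ T ∈ (generatedVonNeumannAlgebra
        (A : Set (Fock V →L[ℂ] Fock V))).toStarSubalgebra := fun T =>
    ampliation_mem_generatedVonNeumannAlgebra θ hθ (fun T hT => (hle hT).2) hone T.2
  refine ⟨{ toFun := fun T => ⟨ampliation θ hθ T, hmem T⟩
            map_smul' := fun c T => Subtype.ext (map_smul (ampliation θ hθ) c T.1)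
            map_zero' := Subtype.ext (map_zero (ampliation θ hθ))
            map_add' := fun S T => Subtype.ext (map_add (ampliation θ hθ) S.1 T.1)
            map_mul' := fun S T => Subtype.ext (map_mul (ampliation θ hθ) S.1 T.1)
            map_star' := fun T => Subtype.ext (map_star (ampliation θ hθ) T.1) }, ?_, ?_⟩
  · intro S T h
    exact Subtype.ext (ampliation_injective θ hθ (congrArg Subtype.val h))
  · intro T hT
    exact (hle hT).2

/-- The algebra of a graph with a double-cycle is partly free. -/
theorem HasDoubleCycle.isPartlyFree [Countable V] [∀ x y : V, Countable (x ⟶ y)]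
    (h : HasDoubleCycle V) : IsPartlyFree (freeSemigroupoidAlgebra V) := by
  obtain ⟨x, c, d, hc, hd, hne⟩ := h
  let p : Fin 2 → Path x x := fun i => if i = 0 then c else d
  have hp : ∀ i, IsCycle (p i) := fun i => by simp only [p]; split_ifs <;> assumption
  refine isPartlyFree_of_paths (κ := Unit) (x := fun _ => x) (t := fun _ => id)
    (fun _ _ _ => rfl) (fun i _ => p i) (fun i _ => (hp i).1) ?_
  rintro i j - - z w w' h
  refine ⟨?_, rfl⟩
  simp only [Sigma.mk.injEq, heq_eq_eq, true_and] at h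
  have h1 := (hp i).eq_of_comp_eq_comp (hp j) h
  by_contra hij
  fin_cases i <;> fin_cases j <;> simp [p] at h1 hij
  · exact hne h1
  · exact hne h1.symm

/-- The algebra of a graph with an infinite path that visits no vertex twice is partly free. -/
theorem InfinitePath.isPartlyFree [Countable V] [∀ x y : V, Countable (x ⟶ y)]
    {ω : InfinitePath V} (hω : Function.Injective ω.vertex) :
    IsPartlyFree (freeSemigroupoidAlgebra V) := by
  -- The maps `k ↦ 2k + 1` and `k ↦ 2k + 2` are injective with disjoint ranges and increase `k`. So
  -- the final vertex alone determines `i` and `k`, and the segments of `ω` have positive length.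
  have hpath : ∀ (i : Fin 2) (k : ℕ), ∃ p : Path (ω.vertex k) (ω.vertex (2 * k + 1 + i)),
      0 < p.length := by
    intro i k
    rw [show 2 * k + 1 + (i : ℕ) = k + (k + 1 + i) by lia]
    exact ⟨ω.segment k _, by simp⟩
  choose p hp using hpath
  refine isPartlyFree_of_paths hω (t := fun i k => 2 * k + 1 + i) p hp ?_
  intro i j k l z w w' h
  have h1 := hω (congrArg (fun q => q.2.1) h)
  have hi := i.2
  have hj := j.2
  exact ⟨Fin.ext (by lia), by lia⟩

end PartlyFree

/-! ### From partly free algebras to partial isometries. -/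

theorem subset_generatedVonNeumannAlgebra {H : Type*} [NormedAddCommGroup H]
    [InnerProductSpace ℂ H] [CompleteSpace H] (S : Set (H →L[ℂ] H)) {T : H →L[ℂ] H} (hT : T ∈ S) :
    T ∈ (generatedVonNeumannAlgebra S).toStarSubalgebra := by
  have key : ∀ X ∈ StarSubalgebra.centralizer ℂ S, X * T = T * X := fun X hX =>
    ((StarSubalgebra.mem_centralizer_iff ℂ).1 hX T hT).1.symm
  exact (StarSubalgebra.mem_centralizer_iff ℂ).2 fun X hX => ⟨key X hX, key _ (star_mem hX)⟩

/-- Images under a `*`-homomorphism of two isometries with orthogonal ranges are partial isometries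
with the same initial projection, which dominates their orthogonal final projections. -/
theorem partialIsometries_of_isometries {H : Type*} [NormedAddCommGroup H] [InnerProductSpace ℂ H]
    [CompleteSpace H] {M : Type*} [Ring M] [StarRing M] [Algebra ℂ M]
    (ψ : M →⋆ₙₐ[ℂ] (H →L[ℂ] H)) {a b : M} (ha : star a * a = 1) (hb : star b * b = 1)
    (hab : star a * b = 0) :
    IsPartialIsometry (ψ a) ∧ IsPartialIsometry (ψ b) ∧ star (ψ a) * ψ a = star (ψ b) * ψ b ∧
      ψ a * star (ψ a) ≤ star (ψ a) * ψ a ∧ ψ b * star (ψ b) ≤ star (ψ b) * ψ b ∧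
      star (ψ a) * ψ b = 0 := by
  have hpi : ∀ c : M, star c * c = 1 → IsPartialIsometry (ψ c) := by
    intro c hc
    rw [IsPartialIsometry, ← map_star, ← map_mul, ← map_mul, mul_assoc, hc, mul_one]
  have hle : ∀ c : M, star c * c = 1 → ψ c * star (ψ c) ≤ star (ψ c) * ψ c := by
    intro c hc
    -- As `1 - c c*` is a projection, its image is positive; `ψ` need not be unital, but the image
    -- of `1` is the common initial projection.
    have h1 : 1 - c * star c = star (1 - c * star c) * (1 - c * star c) := by
      have h2 : c * star c * (c * star c) = c * star c := by
        rw [mul_assoc, ← mul_assoc (star c), hc, one_mul]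
      rw [star_sub, star_one, star_mul, star_star, mul_sub, sub_mul, sub_mul, h2]
      simp
    rw [← sub_nonneg, ← map_star, ← map_mul, ← map_mul, ← map_sub, hc, h1, map_mul, map_star]
    exact star_mul_self_nonneg _
  refine ⟨hpi a ha, hpi b hb, ?_, hle a ha, hle b hb, ?_⟩
  · rw [← map_star, ← map_star, ← map_mul, ← map_mul, ha, hb]
  · rw [← map_star, ← map_mul, hab, map_zero]

/-- A partly free algebra contains two nonzero partial isometries with the same initial projection,
which dominates their orthogonal final projections. -/
theorem IsPartlyFree.exists_partialIsometries {H : Type*} [NormedAddCommGroup H]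
    [InnerProductSpace ℂ H] [CompleteSpace H] {A : NonUnitalSubalgebra ℂ (H →L[ℂ] H)}
    (h : IsPartlyFree A) :
    ∃ U ∈ A, ∃ W ∈ A, IsPartialIsometry U ∧ IsPartialIsometry W ∧ U ≠ 0 ∧ W ≠ 0 ∧
      star U * U = star W * W ∧ U * star U ≤ star U * U ∧ W * star W ≤ star W * W ∧
      star U * W = 0 := by
  obtain ⟨φ, hφ, hmem⟩ := h
  let e : Fin 2 → (SingleObj.star (Fin 2) ⟶ SingleObj.star (Fin 2)) := SingleObj.toHom
  have hL : ∀ i, creation (e i).toPath ∈ freeSemigroupAlgebraTwo := fun i => creation_mem _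
  let L : Fin 2 → (generatedVonNeumannAlgebra
      (freeSemigroupAlgebraTwo : Set (Fock TwoLoops →L[ℂ] Fock TwoLoops))).toStarSubalgebra :=
    fun i => ⟨creation (e i).toPath, subset_generatedVonNeumannAlgebra _ (hL i)⟩
  have hLL : ∀ i, star (L i) * L i = 1 := by
    intro i
    refine Subtype.ext (clm_ext_stdBasis ?_)
    rintro ⟨a, b, w⟩
    obtain rfl : b = SingleObj.star (Fin 2) := rfl
    change star (creation (e i).toPath) (creation (e i).toPath (ξ _)) = ξ _
    rw [creation_apply, creation_eq_partialMap, star_partialMap]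
    exact partialMap_apply (followBy (e i).toPath) (pathsTo _) ⟨a, w⟩
  have hort : star (L 0) * L 1 = 0 := by
    refine Subtype.ext (clm_ext_stdBasis ?_)
    rintro ⟨a, b, w⟩
    obtain rfl : b = SingleObj.star (Fin 2) := rfl
    change star (creation (e 0).toPath) (creation (e 1).toPath (ξ _)) = 0
    rw [creation_apply, creation_eq_partialMap, star_partialMap]
    refine partialMap_apply_of_notMem _ _ ?_
    rintro ⟨⟨z, w'⟩, hk⟩
    obtain rfl : z = a := rfl
    change (⟨z, _, w'.cons (e 0)⟩ : FreeSemigroupoid TwoLoops) = ⟨z, _, w.cons (e 1)⟩ at hk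
    simp only [Sigma.mk.injEq, heq_eq_eq, true_and, Path.cons.injEq] at hk
    exact absurd (SingleObj.toHom.injective hk.2) (by decide)
  have hne : ∀ i, L i ≠ 0 := by
    intro i h0
    have h2 := hLL i
    rw [h0, mul_zero] at h2
    have h3 := ContinuousLinearMap.ext_iff.1 (congrArg Subtype.val h2)
      (ξ ⟨SingleObj.star _, SingleObj.star _, .nil⟩)
    exact stdBasis_ne_zero _ h3.symm
  let ψ := (((generatedVonNeumannAlgebra (A : Set (H →L[ℂ] H))).toStarSubalgebra.subtype :
    _ →⋆ₐ[ℂ] (H →L[ℂ] H)) : _ →⋆ₙₐ[ℂ] (H →L[ℂ] H)).comp φ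
  have hψ : ∀ i, ψ (L i) ≠ 0 := by
    intro i h0
    have h1 : φ (L i) = 0 := Subtype.ext h0
    exact hne i ((map_eq_zero_iff φ hφ).1 h1)
  obtain ⟨h1, h2, h3, h4, h5, h6⟩ := partialIsometries_of_isometries ψ (hLL 0) (hLL 1) hort
  exact ⟨ψ (L 0), hmem _ (hL 0), ψ (L 1), hmem _ (hL 1), h1, h2, hψ 0, hψ 1, h3, h4, h5, h6⟩

end DirGraph

/-! ### The cycle of implications. -/

theorem theorem2p5 (V : Type u) [Quiver.{v} V] [Countable V] [∀ x y : V, Countable (x ⟶ y)] :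
    List.TFAE
      [ ∃ ω : DirGraph.InfinitePath V, ¬ ω.IsEventuallyPeriodic,
        DirGraph.HasDoubleCycle V ∨ ∃ ω : DirGraph.InfinitePath V, ω.IsProper,
        DirGraph.IsPartlyFree (DirGraph.freeSemigroupoidAlgebra V),
        ∃ U ∈ DirGraph.freeSemigroupoidAlgebra V, ∃ W ∈ DirGraph.freeSemigroupoidAlgebra V,
          DirGraph.IsPartialIsometry U ∧ DirGraph.IsPartialIsometry W ∧ U ≠ 0 ∧ W ≠ 0 ∧
          star U * U = star W * W ∧ U * star U ≤ star U * U ∧ W * star W ≤ star W * W ∧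
          star U * W = 0 ] := by
  tfae_have 1 → 2 := by
    rintro ⟨ω, hω⟩
    by_cases h : DirGraph.HasDoubleCycle V
    · exact Or.inl h
    · obtain ⟨ω', hω'⟩ := DirGraph.exists_injective_vertex h ω hω
      exact Or.inr ⟨ω', DirGraph.InfinitePath.isProper_of_injective hω'⟩
  tfae_have 2 → 3 := by
    intro h
    by_cases hdc : DirGraph.HasDoubleCycle V
    · exact hdc.isPartlyFree
    · obtain ⟨ω, hω⟩ := h.resolve_left hdc
      obtain ⟨ω', hω'⟩ := DirGraph.exists_injective_vertex hdc ω hω.not_isEventuallyPeriodic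
      exact DirGraph.InfinitePath.isPartlyFree hω'
  tfae_have 3 → 4 := fun h => h.exists_partialIsometries
  tfae_have 4 → 1 := by
    rintro ⟨U, hU, W, hW, hUp, -, hU0, -, hUW, hUle, hWle, hort⟩
    exact DirGraph.exists_aperiodic_of_partialIsometries hU hW hUp hU0 hUW hUle hWle hort
  tfae_finish
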